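/- Let $c=(c_{ij})_{0\le i,j\le 3}$ be real numbers such that the tropical polynomial $\max_{0\le i,j\le 3}(c_{ij}+ix+jy)$ defines a smooth tropical curve $\Gamma$ of bidegree $(3,3)$: its Newton subdivision is a unimodular triangulation of the square $[0,3]^2$. For $p\in\mathbb R^2$ let $p^\vee$ be the set of exponents $(i,j)$ whose monomials attain the maximum at $p$; thus $\Gamma=\{p:|p^\vee|\ge 2\}$. The sets on which $p^\vee$ is constant are the open cells of the polyhedral structure induced by $\Gamma$ on $\mathbb R^2$; in particular $(i,j)^\vee=\{p : p^\vee=\{(i,j)\}\}$ is the chamber of $\mathbb R^2\smallsetminus\Gamma$ dual to $(i,j)$. A point $(v_0,\ell)\in\mathbb R^2\times\mathbb R$ encodes the tropical $(1,1)$-curve $\Lambda$ with lowest vertex $v_0$ and signed edge length $\ell$: its other vertex is $v_1=v_0+\ell(1,1)$ if $\ell\ge 0$ (edge of slope $1$) and $v_1=v_0-\ell(-1,1)$ if $\ell\le 0$ (edge of slope $-1$); for $\ell=0$ it is the 4-valent curve with vertex $v_0=v_1$. The curve $\Lambda$ is tritangent to $\Gamma$ if $\Lambda\cap\Gamma$ has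 either three connected components, each of total stable intersection multiplicity $2$, or two components, of total stable intersection multiplicities $2$ and $4$, or just one, of total stable intersection multiplicity $6$. A tritangent class $\Omega$ of $\Gamma$ is a connected component of the set of all $(v_0,\ell)\in\mathbb R^3$ that encode curves tritangent to $\Gamma$. Endow $\Omega$ with a polyhedral complex structure compatible with $\Gamma$: for each cell $C$ of $\Omega$, each of the two vertices $v_0$, $v_1$ of a member varies within a single open cell of the structure induced by $\Gamma$ on $\mathbb R^2$ as the member ranges over the relative interior $C^\circ$. The bounded subcomplex $\Omega^b$ is the collection of the cells $C$ of $\Omega$ for which no $(v_0,\ell)\in C^\circ$ satisfies any of the following conditions: 1. $\ell>0$ and $v_0\in(0,0)^\vee$; or $\ell>0$ and $v_1\in(3,3)^\vee$; or $\ell<0$ and $v_0\in(3,0)^\vee$; or $\ell<0$ and $v_1\in(0,3)^\vee$. 2. $\ell>0$, $v_0^\vee\supseteq\{(1,0),(0,1)\}$ and $(i,2-i)\notin v_0^\vee$ for $i=0,1,2$. 3. $\ell>0$, $v_1^\vee\supseteq\{(2,3),(3,2)\}$ and $(1+i,3-i)\notin v_1^\vee$ for $i=0,1,2$. 4. $\ell<0$,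 $v_0^\vee\supseteq\{(2,0),(3,1)\}$ and $(1+i,i)\notin v_0^\vee$ for $i=0,1,2$. 5. $\ell<0$, $v_1^\vee\supseteq\{(0,2),(1,3)\}$ and $(i,1+i)\notin v_1^\vee$ for $i=0,1,2$. Then the support $|\Omega^b|$ (the union of the cells of $\Omega^b$) is a strong deformation retract of the support $|\Omega|$ (the tritangent class itself). In particular $|\Omega^b|$ is connected as a subset of $\mathbb R^3$ with the subspace topology. -/

import Mathlib

open Set Filter Topology

noncomputable section

namespace TropicalTritangent

/-! ### Tropical curves in the plane (max convention) -/

/-- The value at `p` of the monomial `c a + a.1 * p.1 + a.2 * p.2` of the tropical polynomial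
`max_a (c a + a.1 * p.1 + a.2 * p.2)` whose Newton polygon is the square of side length `d`. -/
def monomial {d : ℕ} (c : Fin (d + 1) × Fin (d + 1) → ℝ) (a : Fin (d + 1) × Fin (d + 1))
    (p : ℝ × ℝ) : ℝ :=
  c a + ((a.1 : ℕ) : ℝ) * p.1 + ((a.2 : ℕ) : ℝ) * p.2

open Classical in
/-- The exponents whose monomials attain the maximum at `p`. Their convex hull is the cell `p^∨`
of the Newton subdivision dual to the open cell (chamber, open edge or vertex) containing `p`
of the polyhedral structure that the tropical curve induces on the plane. Two points lie in the
same open cell if and only if these sets agree. -/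
def dualCell {d : ℕ} (c : Fin (d + 1) × Fin (d + 1) → ℝ) (p : ℝ × ℝ) :
    Finset (Fin (d + 1) × Fin (d + 1)) :=
  {a | ∀ b, monomial c b p ≤ monomial c a p}

theorem dualCell_nonempty {d : ℕ} (c : Fin (d + 1) × Fin (d + 1) → ℝ) (p : ℝ × ℝ) :
    (dualCell c p).Nonempty := by
  obtain ⟨a, -, ha⟩ := Finset.exists_max_image
    (Finset.univ : Finset (Fin (d + 1) × Fin (d + 1))) (fun b => monomial c b p)
    Finset.univ_nonempty
  exact ⟨a, by simpa [dualCell] using fun i j => ha (i, j) (Finset.mem_univ _)⟩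

/-- The tropical curve of bidegree `(d, d)` with coefficients `c`: the corner locus in `ℝ²` of the
tropical polynomial, i.e. the points where the maximum is attained at least twice. -/
def curve {d : ℕ} (c : Fin (d + 1) × Fin (d + 1) → ℝ) : Set (ℝ × ℝ) :=
  {p | 1 < (dualCell c p).card}

/-- Twice the signed area of the triangle with vertices `a`, `b`, `e`. -/
def latticeDet {d : ℕ} (a b e : Fin (d + 1) × Fin (d + 1)) : ℤ :=
  (((b.1 : ℕ) : ℤ) - ((a.1 : ℕ) : ℤ)) * (((e.2 : ℕ) : ℤ) - ((a.2 : ℕ) : ℤ)) -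
    (((b.2 : ℕ) : ℤ) - ((a.2 : ℕ) : ℤ)) * (((e.1 : ℕ) : ℤ) - ((a.1 : ℕ) : ℤ))

/-- The curve is smooth: the Newton subdivision is a unimodular triangulation of the square, i.e.
every cell has at most three marked points, and three marked points of a cell span a
triangle of area `1 / 2`. -/
def IsSmooth {d : ℕ} (c : Fin (d + 1) × Fin (d + 1) → ℝ) : Prop :=
  ∀ p, (dualCell c p).card ≤ 3 ∧
    ∀ a ∈ dualCell c p, ∀ b ∈ dualCell c p, ∀ e ∈ dualCell c p,
      a ≠ b → a ≠ e → b ≠ e → |latticeDet a b e| = 1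

/-- The chamber `a^∨`: the connected component of the complement of the curve that is dual to the
lattice point `a`. -/
def chamber {d : ℕ} (c : Fin (d + 1) × Fin (d + 1) → ℝ) (a : Fin (d + 1) × Fin (d + 1)) :
    Set (ℝ × ℝ) :=
  {p | dualCell c p = {a}}

/-! ### Curves of bidegree `(1, 1)` -/

/-- The parameter space of `(1, 1)`-curves: pairs `(v₀, l)` of the lowest vertex and the signed
length of the edge. -/
abbrev Params : Type := (ℝ × ℝ) × ℝ

/-- The lowest vertex. -/
def vertexZero (x : Params) : ℝ × ℝ := x.1

/-- The other vertex: `v₀ + l (1, 1)` if `0 ≤ l`, and `v₀ - l (-1, 1)` if `l ≤ 0`. -/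
def vertexOne (x : Params) : ℝ × ℝ := (x.1.1 + x.2, x.1.2 + |x.2|)

/-- Coefficients of a tropical polynomial `max {0, B + s, C + t, D + s + t}` whose curve has lowest
vertex `v₀` and signed edge length `l = B + C - D`. -/
def lineCoeff (x : Params) : Fin (1 + 1) × Fin (1 + 1) → ℝ := fun a =>
  if a = (0, 0) then 0
  else if a = (1, 0) then -x.1.1
  else if a = (0, 1) then -x.1.2 + min x.2 0
  else -x.1.1 - x.1.2 - max x.2 0

/-- The tropical `(1, 1)`-curve encoded by the point `x = (v₀, l)`. -/
def line (x : Params) : Set (ℝ × ℝ) := curve (lineCoeff x)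

/-- The primitive vectors that can be directions of edges of a `(1, 1)`-curve. -/
def directions : Finset (ℤ × ℤ) :=
  {(1, 0), (-1, 0), (0, 1), (0, -1), (1, 1), (-1, -1), (1, -1), (-1, 1)}

open Classical in
/-- The primitive outgoing directions at `p` of the edges of the `(1, 1)`-curve encoded by `x`. -/
def outgoing (x : Params) (p : ℝ × ℝ) : Finset (ℤ × ℤ) :=
  {u ∈ directions | ∀ᶠ ε : ℝ in 𝓝[>] 0, (p.1 + ε * (u.1 : ℝ), p.2 + ε * (u.2 : ℝ)) ∈ line x}

/-- The outgoing slope at `p`, in direction `u`, of the tropical polynomial with coefficients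
`c`. -/
def outgoingSlope {d : ℕ} (c : Fin (d + 1) × Fin (d + 1) → ℝ) (p : ℝ × ℝ) (u : ℤ × ℤ) : ℤ :=
  (dualCell c p).sup' (dualCell_nonempty c p)
    (fun a => ((a.1 : ℕ) : ℤ) * u.1 + ((a.2 : ℕ) : ℤ) * u.2)

/-- The multiplicity at `p` of the stable intersection of the `(1, 1)`-curve encoded by `x` with
the curve with coefficients `c`, as the order at `p` of the divisor cut out on the `(1, 1)`-curve
(all of whose edges have weight one) by the tropical polynomial with coefficients `c`.

Displace the `(1, 1)`-curve by a small generic vector `w` and let `b ∈ dualCell c p` be the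
exponent that dominates in direction `w`. Near `p`, the displaced edge with direction `u` then
crosses the other curve with total multiplicity `outgoingSlope c p u - ⟨b, u⟩`, and the terms
`⟨b, u⟩` add up to zero by the balancing condition. Hence this is the multiplicity given by the
fan displacement rule; it is `|det|` of the primitive directions, times weights, at a transverse
intersection of two edges. -/
def stableMult {d : ℕ} (c : Fin (d + 1) × Fin (d + 1) → ℝ) (x : Params) (p : ℝ × ℝ) : ℤ :=
  ∑ u ∈ outgoing x p, outgoingSlope c p u

/-- The total stable intersection multiplicity along a subset `Y` of the intersection. Only
finitely many points have non-zero multiplicity. -/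
def totalMult {d : ℕ} (c : Fin (d + 1) × Fin (d + 1) → ℝ) (x : Params) (Y : Set (ℝ × ℝ)) : ℤ :=
  ∑ᶠ p ∈ Y, stableMult c x p

/-- The connected components of the intersection of the `(1, 1)`-curve encoded by `x` with the
curve with coefficients `c`. Two legs that reach the boundary of the compactification of
`ℝ²` to the product of two tropical projective lines meet there if and only if they overlap in a
ray of `ℝ²`, so taking closures does not change the components. -/
def intersectionComponents {d : ℕ} (c : Fin (d + 1) × Fin (d + 1) → ℝ) (x : Params) :
    Set (Set (ℝ × ℝ)) :=
  {Y | ∃ p ∈ line x ∩ curve c, Y = connectedComponentIn (line x ∩ curve c) p}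

/-- The `(1, 1)`-curve encoded by `x` is tritangent to the `(3, 3)`-curve with coefficients `c`. -/
def IsTritangent (c : Fin (3 + 1) × Fin (3 + 1) → ℝ) (x : Params) : Prop :=
  (∃ Y₁ Y₂ Y₃, Y₁ ≠ Y₂ ∧ Y₁ ≠ Y₃ ∧ Y₂ ≠ Y₃ ∧ intersectionComponents c x = {Y₁, Y₂, Y₃} ∧
      totalMult c x Y₁ = 2 ∧ totalMult c x Y₂ = 2 ∧ totalMult c x Y₃ = 2) ∨
  (∃ Y₁ Y₂, Y₁ ≠ Y₂ ∧ intersectionComponents c x = {Y₁, Y₂} ∧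
      totalMult c x Y₁ = 2 ∧ totalMult c x Y₂ = 4) ∨
  (∃ Y, intersectionComponents c x = {Y} ∧ totalMult c x Y = 6)

/-- `T` is a tritangent class: a connected component of the set of all points `(v₀, l)` that encode
tritangent `(1, 1)`-curves. -/
def IsTritangentClass (c : Fin (3 + 1) × Fin (3 + 1) → ℝ) (T : Set Params) : Prop :=
  ∃ x, IsTritangent c x ∧ T = connectedComponentIn {y | IsTritangent c y} x

/-! ### Polyhedral complexes -/

/-- A polyhedron: an intersection of finitely many closed half-spaces. -/
def IsPolyhedron (C : Set Params) : Prop :=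
  ∃ s : Finset ((Params →L[ℝ] ℝ) × ℝ), C = {x | ∀ h ∈ s, h.1 x ≤ h.2}

/-- A polyhedral complex in the parameter space: a collection of non-empty polyhedra that contains
all non-empty faces of its members, and in which any two members that meet do so in a common
face. (The faces of a polyhedron are its exposed faces.) -/
structure PolyhedralComplex where
  cells : Set (Set Params)
  nonempty_of_mem : ∀ C ∈ cells, C.Nonempty
  isPolyhedron_of_mem : ∀ C ∈ cells, IsPolyhedron C
  face_mem : ∀ C ∈ cells, ∀ F : Set Params, F.Nonempty → IsExposed ℝ C F → F ∈ cells
  isExposed_inter : ∀ C ∈ cells, ∀ D ∈ cells, (C ∩ D).Nonempty →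
    IsExposed ℝ C (C ∩ D) ∧ IsExposed ℝ D (C ∩ D)

/-- The union of a collection of cells. -/
def support (cells : Set (Set Params)) : Set Params := ⋃₀ cells

/-- The polyhedral complex is compatible with the polyhedral structure induced on the plane by the
curve with coefficients `c`: for each cell, each of the two vertices of the members in the
relative interior of that cell stays in one fixed open cell of the plane. -/
def PolyhedralComplex.IsCompatible (K : PolyhedralComplex)
    (c : Fin (3 + 1) × Fin (3 + 1) → ℝ) : Prop :=
  ∀ C ∈ K.cells, ∀ x ∈ intrinsicInterior ℝ C, ∀ y ∈ intrinsicInterior ℝ C,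
    dualCell c (vertexZero x) = dualCell c (vertexZero y) ∧
    dualCell c (vertexOne x) = dualCell c (vertexOne y)

/-! ### The bounded subcomplex -/

/-- The condition on a member that defines the collections `U₀⁺`, `U₁⁺`, `U₀⁻`, `U₁⁻`. -/
def InU (c : Fin (3 + 1) × Fin (3 + 1) → ℝ) (x : Params) : Prop :=
  (0 < x.2 ∧ vertexZero x ∈ chamber c (0, 0)) ∨
  (0 < x.2 ∧ vertexOne x ∈ chamber c (3, 3)) ∨
  (x.2 < 0 ∧ vertexZero x ∈ chamber c (3, 0)) ∨
  (x.2 < 0 ∧ vertexOne x ∈ chamber c (0, 3))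

/-- The condition on a member that defines the collections `R₀⁺`, `R₁⁺`, `R₀⁻`, `R₁⁻`. -/
def InR (c : Fin (3 + 1) × Fin (3 + 1) → ℝ) (x : Params) : Prop :=
  (0 < x.2 ∧ {(1, 0), (0, 1)} ⊆ dualCell c (vertexZero x) ∧
    Disjoint {(0, 2), (1, 1), (2, 0)} (dualCell c (vertexZero x))) ∨
  (0 < x.2 ∧ {(2, 3), (3, 2)} ⊆ dualCell c (vertexOne x) ∧
    Disjoint {(1, 3), (2, 2), (3, 1)} (dualCell c (vertexOne x))) ∨
  (x.2 < 0 ∧ {(2, 0), (3, 1)} ⊆ dualCell c (vertexZero x) ∧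
    Disjoint {(1, 0), (2, 1), (3, 2)} (dualCell c (vertexZero x))) ∨
  (x.2 < 0 ∧ {(0, 2), (1, 3)} ⊆ dualCell c (vertexOne x) ∧
    Disjoint {(0, 1), (1, 2), (2, 3)} (dualCell c (vertexOne x)))

/-- The bounded subcomplex: the cells of `K` that remain when all cells are removed whose relative
interior has a member satisfying one of the eight conditions. -/
def PolyhedralComplex.boundedCells (K : PolyhedralComplex)
    (c : Fin (3 + 1) × Fin (3 + 1) → ℝ) : Set (Set Params) :=
  {C ∈ K.cells | ¬ ∃ x ∈ intrinsicInterior ℝ C, InU c x ∨ InR c x}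

/-! ### Deformation retracts -/

/-- `A` is a strong deformation retract of `X` (both with the subspace topology): there is a
continuous map `r` of `X` to itself with values in `A`, and a homotopy from the identity of `X`
to `r` that fixes every point of `A` at all times. -/
def IsStrongDeformationRetract {E : Type*} [TopologicalSpace E] (A X : Set E) : Prop :=
  A ⊆ X ∧ ∃ r : C(X, X), (∀ x, (r x : E) ∈ A) ∧
    (ContinuousMap.id X).HomotopicRel r {x : X | (x : E) ∈ A}

end TropicalTritangent

end

/-! Take ℓ > 0 and slide v₀ along the edge towards v₁ while v₀^∨ contains only exponents of degree
at most one. Parity leaves two positions for v₀. If v₀ lies in the chamber of a, the components of Λ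
∩ Γ on the left leg are cut off from the rest and have total multiplicity a.1, so a.1 is even
(`even_fst_of_dualCell_eq_singleton`). If v₀ lies on the open edge dual to {(0,0), (1,0)}, its
component has multiplicity 1 (`not_dualCell_vertexZero_subset`). Together with the transposed
statements this puts v₀ in the chamber of (0,0), or makes (1,0) and (0,1) both maximal at v₀. In the
first case Λ misses Γ below the new vertex; in the second the edge of Λ runs along an edge of Γ.
Either way, the part of Λ ∩ Γ that is swept is connected to the new vertex and its multiplicity is
conserved, so tritangency persists (`hasTritangentType_collapse`, `isTritangent_shrink`).

The motion ends when an exponent of degree at least two becomes maximal or when ℓ = 0. This time is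
a continuous function of (v₀, ℓ) after truncation at 0, so the motion is a flow on the whole
parameter space that fixes every curve with nothing to shrink (`isRetraction_shrinkFlow`).
Reflections give the analogous flows for v₁ and for ℓ < 0, and the composite retracts each
tritangent class onto its non-shrinkable members.

These members form |Ω^b| (`support_boundedCells`). By unimodularity, being shrinkable means
satisfying one of the eight removal conditions (`isShrinkable_iff`). Shrinkability is open, so a
cell containing a shrinkable member is removed; it is constant on relative interiors of cells, so a
non-shrinkable member survives in the cell whose relative interior contains it. -/

noncomputable section

namespace TropicalTritangent

section

/-! ### Dual cells along rays -/

/-- The pairing of an exponent with an integral direction. -/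
def pairing {d : ℕ} (a : Fin (d + 1) × Fin (d + 1)) (u : ℤ × ℤ) : ℤ :=
  ((a.1 : ℕ) : ℤ) * u.1 + ((a.2 : ℕ) : ℤ) * u.2

/-- The point reached from `p` after time `t` in direction `u`. -/
def move (p : ℝ × ℝ) (t : ℝ) (u : ℤ × ℤ) : ℝ × ℝ := (p.1 + t * (u.1 : ℝ), p.2 + t * (u.2 : ℝ))

variable {d : ℕ} {c : Fin (d + 1) × Fin (d + 1) → ℝ} {p q : ℝ × ℝ}
  {a b : Fin (d + 1) × Fin (d + 1)}

theorem mem_dualCell : a ∈ dualCell c p ↔ ∀ b, monomial c b p ≤ monomial c a p := by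
  simp [dualCell]

theorem monomial_eq_of_mem_dualCell (ha : a ∈ dualCell c p) (hb : b ∈ dualCell c p) :
    monomial c a p = monomial c b p :=
  le_antisymm (mem_dualCell.1 hb a) (mem_dualCell.1 ha b)

theorem mem_dualCell_iff_eq (ha : a ∈ dualCell c p) :
    b ∈ dualCell c p ↔ monomial c b p = monomial c a p := by
  refine ⟨fun hb => monomial_eq_of_mem_dualCell hb ha, fun h => mem_dualCell.2 fun e => ?_⟩
  rw [h]; exact mem_dualCell.1 ha e

theorem monomial_lt_of_notMem_dualCell (ha : a ∈ dualCell c p) (hb : b ∉ dualCell c p) :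
    monomial c b p < monomial c a p :=
  lt_of_le_of_ne (mem_dualCell.1 ha b) fun h => hb ((mem_dualCell_iff_eq ha).2 h)

theorem mem_curve : p ∈ curve c ↔ ∃ a ∈ dualCell c p, ∃ b ∈ dualCell c p, a ≠ b :=
  Finset.one_lt_card

theorem notMem_curve_of_dualCell_eq_singleton (h : dualCell c p = {a}) : p ∉ curve c := by
  simp [curve, h]

theorem monomial_move (t : ℝ) (u : ℤ × ℤ) :
    monomial c a (move p t u) = monomial c a p + t * (pairing a u : ℝ) := by
  simp only [monomial, move, pairing]; push_cast; ring

@[simp] theorem move_zero (p : ℝ × ℝ) (u : ℤ × ℤ) : move p 0 u = p := by simp [move]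

/-- In a direction that is maximal on `a ∈ p^∨` among all exponents, the dual cell is constant. -/
theorem mem_dualCell_move_of_forall_le (ha : a ∈ dualCell c p) {u : ℤ × ℤ}
    (hu : ∀ b : Fin (d + 1) × Fin (d + 1), pairing b u ≤ pairing a u) {t : ℝ} (ht : 0 < t) :
    b ∈ dualCell c (move p t u) ↔ b ∈ dualCell c p ∧ pairing b u = pairing a u := by
  have key : ∀ b : Fin (d + 1) × Fin (d + 1), (pairing b u : ℝ) ≤ pairing a u :=
    fun b => by exact_mod_cast hu b
  have ha' : a ∈ dualCell c (move p t u) := mem_dualCell.2 fun e => by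
    rw [monomial_move, monomial_move]
    exact add_le_add (mem_dualCell.1 ha e) (mul_le_mul_of_nonneg_left (key e) ht.le)
  rw [mem_dualCell_iff_eq ha', mem_dualCell_iff_eq ha, monomial_move, monomial_move]
  have h1 := mem_dualCell.1 ha b
  have h2 := mul_le_mul_of_nonneg_left (key b) ht.le
  constructor
  · intro h
    have h3 : t * (pairing b u : ℝ) = t * pairing a u := by linarith
    refine ⟨by linarith, ?_⟩
    exact_mod_cast mul_left_cancel₀ ht.ne' h3
  · rintro ⟨h3, h4⟩; rw [h3, h4]

/-- For small t the finitely many strict inequalities at p persist, and among the exponents tied at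
p the slope in direction u decides. -/
theorem eventually_mem_dualCell_move (c : Fin (d + 1) × Fin (d + 1) → ℝ) (p : ℝ × ℝ) (u : ℤ × ℤ) :
    ∀ᶠ t : ℝ in 𝓝[>] 0, ∀ a, a ∈ dualCell c (move p t u) ↔
      a ∈ dualCell c p ∧ ∀ b ∈ dualCell c p, pairing b u ≤ pairing a u := by
  obtain ⟨e, he, hmax⟩ := Finset.exists_max_image (dualCell c p) (fun b => pairing b u)
    (dualCell_nonempty c p)
  have h1 : ∀ᶠ t : ℝ in 𝓝[>] 0, ∀ b, b ∉ dualCell c p →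
      monomial c b (move p t u) < monomial c e (move p t u) := by
    rw [eventually_all]
    intro b
    by_cases hb : b ∈ dualCell c p
    · simp [hb]
    have h2 := monomial_lt_of_notMem_dualCell he hb
    have h3 : Continuous fun t : ℝ => monomial c e (move p t u) - monomial c b (move p t u) := by
      simp only [monomial_move]; fun_prop
    have h4 : ∀ᶠ t : ℝ in 𝓝 0, 0 < monomial c e (move p t u) - monomial c b (move p t u) :=
      h3.continuousAt.eventually (lt_mem_nhds (by simpa using h2))
    filter_upwards [nhdsWithin_le_nhds h4] with t ht _ using by linarith
  filter_upwards [h1, self_mem_nhdsWithin] with t ht (ht0 : 0 < t)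
  have he' : e ∈ dualCell c (move p t u) := mem_dualCell.2 fun b => by
    by_cases hb : b ∈ dualCell c p
    · rw [monomial_move, monomial_move, monomial_eq_of_mem_dualCell hb he]
      have : (pairing b u : ℝ) ≤ pairing e u := by exact_mod_cast hmax b hb
      nlinarith
    · exact (ht b hb).le
  intro a
  rw [mem_dualCell_iff_eq he']
  constructor
  · intro h
    have ha : a ∈ dualCell c p := by
      by_contra hb
      exact (ht a hb).ne h
    refine ⟨ha, fun b hb => ?_⟩
    rw [monomial_move, monomial_move, monomial_eq_of_mem_dualCell ha he] at h
    have h3 : t * (pairing a u : ℝ) = t * pairing e u := by linarith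
    have : pairing a u = pairing e u := by exact_mod_cast mul_left_cancel₀ ht0.ne' h3
    rw [this]; exact hmax b hb
  · rintro ⟨ha, hb⟩
    rw [monomial_move, monomial_move, monomial_eq_of_mem_dualCell ha he,
      le_antisymm (hmax a ha) (hb e he)]

/-- A supremum of slopes, from a maximal exponent. -/
theorem outgoingSlope_eq {u : ℤ × ℤ} {n : ℤ} (ha : a ∈ dualCell c p) (hn : pairing a u = n)
    (h : ∀ b ∈ dualCell c p, pairing b u ≤ n) : outgoingSlope c p u = n := by
  refine le_antisymm (Finset.sup'_le _ _ h) ?_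
  rw [← hn]
  exact Finset.le_sup' (fun a : Fin (d + 1) × Fin (d + 1) =>
    ((a.1 : ℕ) : ℤ) * u.1 + ((a.2 : ℕ) : ℤ) * u.2) ha

/-! ### Curves of bidegree `(1, 1)` -/

/-- The directions in which a `(1, 1)`-curve leaves a point with dual cell `D`. -/
def lineDirections (D : Finset (Fin (1 + 1) × Fin (1 + 1))) : Finset (ℤ × ℤ) :=
  directions.filter fun u => 1 < (D.filter fun a => ∀ b ∈ D, pairing b u ≤ pairing a u).card

/-- Replaces a germ condition by a finite function of the dual cell, which `decide` can evaluate. -/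
theorem outgoing_eq (x : Params) (p : ℝ × ℝ) :
    outgoing x p = lineDirections (dualCell (lineCoeff x) p) := by
  classical
  ext u
  simp only [outgoing, lineDirections, Finset.mem_filter]
  refine and_congr_right fun _ => ?_
  have h := eventually_mem_dualCell_move (lineCoeff x) p u
  have h2 : ∀ᶠ t : ℝ in 𝓝[>] 0, ((p.1 + t * (u.1 : ℝ), p.2 + t * (u.2 : ℝ)) ∈ line x ↔
      1 < ((dualCell (lineCoeff x) p).filter fun a =>
        ∀ b ∈ dualCell (lineCoeff x) p, pairing b u ≤ pairing a u).card) := by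
    filter_upwards [h] with t ht
    have : dualCell (lineCoeff x) (move p t u) = (dualCell (lineCoeff x) p).filter fun a =>
        ∀ b ∈ dualCell (lineCoeff x) p, pairing b u ≤ pairing a u := by
      ext a; rw [ht a, Finset.mem_filter]
    rw [← this]; rfl
  rw [eventually_congr h2, eventually_const]

/-- The balancing condition. It makes multiplicities insensitive to adding a linear form to the
slopes. -/
theorem sum_lineDirections :
    ∀ D, (∑ u ∈ lineDirections D, u.1) = 0 ∧ (∑ u ∈ lineDirections D, u.2) = 0 := by
  decide

theorem monomial_lineCoeff (x : Params) (p : ℝ × ℝ) :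
    monomial (lineCoeff x) (0, 0) p = 0 ∧ monomial (lineCoeff x) (1, 0) p = p.1 - x.1.1 ∧
    monomial (lineCoeff x) (0, 1) p = p.2 - x.1.2 + min x.2 0 ∧
    monomial (lineCoeff x) (1, 1) p = p.1 - x.1.1 + (p.2 - x.1.2) - max x.2 0 := by
  refine ⟨?_, ?_, ?_, ?_⟩ <;> simp [monomial, lineCoeff] <;> ring

theorem mem_dualCell_lineCoeff {x : Params} {p : ℝ × ℝ} {a : Fin (1 + 1) × Fin (1 + 1)} :
    a ∈ dualCell (lineCoeff x) p ↔
      0 ≤ monomial (lineCoeff x) a p ∧ p.1 - x.1.1 ≤ monomial (lineCoeff x) a p ∧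
      p.2 - x.1.2 + min x.2 0 ≤ monomial (lineCoeff x) a p ∧
      p.1 - x.1.1 + (p.2 - x.1.2) - max x.2 0 ≤ monomial (lineCoeff x) a p := by
  obtain ⟨h0, h1, h2, h3⟩ := monomial_lineCoeff x p
  rw [mem_dualCell]
  constructor
  · intro h
    refine ⟨?_, ?_, ?_, ?_⟩
    · rw [← h0]; exact h _
    · rw [← h1]; exact h _
    · rw [← h2]; exact h _
    · rw [← h3]; exact h _
  · rintro ⟨k0, k1, k2, k3⟩ ⟨i, j⟩
    fin_cases i <;> fin_cases j
    · exact h0.trans_le k0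
    · exact h2.trans_le k2
    · exact h1.trans_le k1
    · exact h3.trans_le k3

end

section

/-! ### Connected components and their multiplicities -/

/-- The set of connected components of `Z`. -/
def components (Z : Set (ℝ × ℝ)) : Set (Set (ℝ × ℝ)) :=
  {Y | ∃ p ∈ Z, Y = connectedComponentIn Z p}

/-- The condition on a collection of components with multiplicities that defines tritangency. -/
def HasTritangentType (A : Set (Set (ℝ × ℝ))) (m : Set (ℝ × ℝ) → ℤ) : Prop :=
  (∃ Y₁ Y₂ Y₃, Y₁ ≠ Y₂ ∧ Y₁ ≠ Y₃ ∧ Y₂ ≠ Y₃ ∧ A = {Y₁, Y₂, Y₃} ∧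
      m Y₁ = 2 ∧ m Y₂ = 2 ∧ m Y₃ = 2) ∨
  (∃ Y₁ Y₂, Y₁ ≠ Y₂ ∧ A = {Y₁, Y₂} ∧ m Y₁ = 2 ∧ m Y₂ = 4) ∨
  (∃ Y, A = {Y} ∧ m Y = 6)

theorem isTritangent_iff {c : Fin (3 + 1) × Fin (3 + 1) → ℝ} {x : Params} :
    IsTritangent c x ↔ HasTritangentType (components (line x ∩ curve c))
      fun Y => ∑ᶠ p ∈ Y, stableMult c x p := Iff.rfl

/-- Evenness is all that the arguments locating the vertices use of tritangency. -/
theorem HasTritangentType.even {A : Set (Set (ℝ × ℝ))} {m : Set (ℝ × ℝ) → ℤ}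
    (h : HasTritangentType A m) {Y : Set (ℝ × ℝ)} (hY : Y ∈ A) : Even (m Y) := by
  rcases h with ⟨Y₁, Y₂, Y₃, -, -, -, rfl, h1, h2, h3⟩ | ⟨Y₁, Y₂, -, rfl, h1, h2⟩ | ⟨Y₁, rfl, h1⟩
  · rcases hY with rfl | rfl | rfl
    · rw [h1]; decide
    · rw [h2]; decide
    · rw [h3]; decide
  · rcases hY with rfl | rfl
    · rw [h1]; decide
    · rw [h2]; decide
  · rw [mem_singleton_iff.1 hY, h1]; decide

theorem HasTritangentType.image {A : Set (Set (ℝ × ℝ))} {m m' : Set (ℝ × ℝ) → ℤ}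
    (h : HasTritangentType A m) {f : Set (ℝ × ℝ) → Set (ℝ × ℝ)} (hf : InjOn f A)
    (hm : ∀ Y ∈ A, m' (f Y) = m Y) : HasTritangentType (f '' A) m' := by
  rcases h with ⟨Y₁, Y₂, Y₃, h12, h13, h23, rfl, h1, h2, h3⟩ | ⟨Y₁, Y₂, h12, rfl, h1, h2⟩ |
    ⟨Y₁, rfl, h1⟩
  · refine Or.inl ⟨f Y₁, f Y₂, f Y₃, fun e => h12 (hf ?_ ?_ e), fun e => h13 (hf ?_ ?_ e),
      fun e => h23 (hf ?_ ?_ e), ?_, ?_, ?_, ?_⟩ <;> try simp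
    · simp [image_insert_eq]
    · rw [hm _ (by simp), h1]
    · rw [hm _ (by simp), h2]
    · rw [hm _ (by simp), h3]
  · refine Or.inr (Or.inl ⟨f Y₁, f Y₂, fun e => h12 (hf ?_ ?_ e), ?_, ?_, ?_⟩) <;>
      try simp
    · simp [image_insert_eq]
    · rw [hm _ (by simp), h1]
    · rw [hm _ (by simp), h2]
  · exact Or.inr (Or.inr ⟨f Y₁, by simp, by rw [hm _ (by simp), h1]⟩)

theorem hasTritangentType_image_iff {A : Set (Set (ℝ × ℝ))} {m m' : Set (ℝ × ℝ) → ℤ}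
    {f : Set (ℝ × ℝ) → Set (ℝ × ℝ)} (hf : InjOn f A) (hm : ∀ Y ∈ A, m' (f Y) = m Y) :
    HasTritangentType (f '' A) m' ↔ HasTritangentType A m := by
  refine ⟨fun h => ?_, fun h => h.image hf hm⟩
  have hinv : ∀ Y ∈ A, Function.invFunOn f A (f Y) = Y := fun Y hY => hf.leftInvOn_invFunOn hY
  have := h.image (f := Function.invFunOn f A) (m' := m) ?_ ?_
  · rwa [hf.invFunOn_image subset_rfl] at this
  · rintro _ ⟨Y, hY, rfl⟩ _ ⟨Y', hY', rfl⟩ e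
    rw [hinv Y hY, hinv Y' hY'] at e; rw [e]
  · rintro _ ⟨Y, hY, rfl⟩
    rw [hinv Y hY, hm Y hY]

/-! ### Collapsing the part of a planar set below a point -/

section Collapse

variable {Z : Set (ℝ × ℝ)} {w : ℝ × ℝ}

/-- The continuous map q ↦ q ⊔ w retracts Z onto `Z ∩ Ici w`, sending everything below w to w, so it
carries components of Z to connected sets. -/
theorem connectedComponentIn_inter_Ici (hZ : Z ⊆ Iic w ∪ Ici w)
    (hw : (Z ∩ Iic w).Nonempty → w ∈ Z) {p : ℝ × ℝ} (hp : p ∈ Z ∩ Ici w) :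
    connectedComponentIn Z p ∩ Ici w = connectedComponentIn (Z ∩ Ici w) p := by
  apply Subset.antisymm
  · have hmap : MapsTo (· ⊔ w) Z (Z ∩ Ici w) := by
      intro q hq
      rcases hZ hq with h | h
      · have : q ⊔ w = w := sup_eq_right.2 h
        simp only [this]
        exact ⟨hw ⟨q, hq, h⟩, mem_Ici.2 le_rfl⟩
      · have : q ⊔ w = q := sup_eq_left.2 h
        simp only [this]
        exact ⟨hq, h⟩
    have hcont : Continuous fun q : ℝ × ℝ => q ⊔ w :=
      ((continuous_fst.max continuous_const).prodMk (continuous_snd.max continuous_const) :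
        Continuous fun q : ℝ × ℝ => (max q.1 w.1, max q.2 w.2))
    have h1 : IsPreconnected ((· ⊔ w) '' connectedComponentIn Z p) :=
      isPreconnected_connectedComponentIn.image _ hcont.continuousOn
    have h2 := h1.subset_connectedComponentIn (x := p) (F := Z ∩ Ici w)
      ⟨p, mem_connectedComponentIn hp.1, sup_eq_left.2 hp.2⟩
      ((image_mono (connectedComponentIn_subset _ _)).trans hmap.image_subset)
    rintro q ⟨hq, hqw⟩
    exact h2 ⟨q, hq, sup_eq_left.2 hqw⟩
  · exact subset_inter (connectedComponentIn_mono _ inter_subset_left)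
      ((connectedComponentIn_subset _ _).trans inter_subset_right)

theorem exists_mem_Ici_of_mem_components (hZ : Z ⊆ Iic w ∪ Ici w)
    (hS : IsPreconnected (Z ∩ Iic w)) (hw : (Z ∩ Iic w).Nonempty → w ∈ Z) {C : Set (ℝ × ℝ)}
    (hC : C ∈ components Z) : ∃ p ∈ Z ∩ Ici w, C = connectedComponentIn Z p := by
  obtain ⟨p, hp, rfl⟩ := hC
  rcases hZ hp with h | h
  · have hw' := hw ⟨p, hp, h⟩
    refine ⟨w, ⟨hw', mem_Ici.2 le_rfl⟩, connectedComponentIn_eq ?_⟩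
    exact hS.subset_connectedComponentIn ⟨hp, h⟩ inter_subset_left ⟨hw', mem_Iic.2 le_rfl⟩
  · exact ⟨p, ⟨hp, h⟩, rfl⟩

theorem finsum_mem_inter_Ici (hZ : Z ⊆ Iic w ∪ Ici w)
    (hS : IsPreconnected (Z ∩ Iic w)) (hw : (Z ∩ Iic w).Nonempty → w ∈ Z) {m m' : ℝ × ℝ → ℤ}
    (hm : ∀ p ∈ Z ∩ Ici w, p ≠ w → m' p = m p)
    (hfin : (Z ∩ Iic w ∩ Function.support m).Finite)
    (hsum : w ∈ Z → ∑ᶠ p ∈ Z ∩ Iic w, m p = m' w) (p : ℝ × ℝ) :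
    ∑ᶠ q ∈ connectedComponentIn Z p ∩ Ici w, m' q = ∑ᶠ q ∈ connectedComponentIn Z p, m q := by
  set C := connectedComponentIn Z p with hC
  have hCZ : C ⊆ Z := connectedComponentIn_subset _ _
  -- A component through w swallows all of `Z ∩ Iic w`, whose multiplicity is charged to w; any
  -- other component avoids `Iic w`.
  by_cases hwC : w ∈ C
  · have hSC : Z ∩ Iic w ⊆ C := by
      rw [hC, connectedComponentIn_eq hwC]
      exact hS.subset_connectedComponentIn ⟨hCZ hwC, mem_Iic.2 le_rfl⟩ inter_subset_left
    set D := (C ∩ Ici w) \ {w} with hD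
    have e1 : C = (Z ∩ Iic w) ∪ D := by
      ext q
      constructor
      · intro hq
        rcases hZ (hCZ hq) with h | h
        · exact Or.inl ⟨hCZ hq, h⟩
        · by_cases hqw : q = w
          · exact Or.inl ⟨hCZ hq, hqw.le⟩
          · exact Or.inr ⟨⟨hq, h⟩, hqw⟩
      · rintro (h | h)
        exacts [hSC h, h.1.1]
    have e2 : C ∩ Ici w = {w} ∪ D := by
      rw [hD, union_sdiff_cancel]
      simpa using hwC
    have d1 : Disjoint (Z ∩ Iic w) D := by
      rw [Set.disjoint_left]
      rintro q ⟨_, h1⟩ ⟨⟨_, h2⟩, h3⟩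
      exact h3 (le_antisymm h1 h2)
    have d2 : Disjoint {w} D := by simp [hD]
    have hDm : ∀ q ∈ D, m' q = m q := fun q hq => hm q ⟨hCZ hq.1.1, hq.1.2⟩ hq.2
    have hDs : D ∩ Function.support m' = D ∩ Function.support m := by
      ext q
      refine and_congr_right fun hq => ?_
      simp [hDm q hq]
    -- With infinite support both sums take the default value 0.
    by_cases hfD : (D ∩ Function.support m).Finite
    · rw [e2, finsum_mem_union' d2 ((finite_singleton w).inter_of_left _) (hDs ▸ hfD)]
      conv_rhs => rw [e1, finsum_mem_union' d1 hfin hfD]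
      rw [finsum_mem_singleton, hsum (hCZ hwC), finsum_mem_congr rfl hDm]
    · rw [finsum_mem_eq_zero_of_infinite, finsum_mem_eq_zero_of_infinite]
      · refine Infinite.mono (inter_subset_inter_left _ ?_) hfD
        exact fun q hq => hq.1.1
      · refine Infinite.mono (s := D ∩ Function.support m') (inter_subset_inter_left _ ?_)
          (hDs ▸ hfD)
        exact fun q hq => hq.1
  · have hSC : ∀ q ∈ C, q ∉ Iic w := by
      intro q hq hqw
      apply hwC
      rw [hC, connectedComponentIn_eq hq]
      exact hS.subset_connectedComponentIn ⟨hCZ hq, hqw⟩ inter_subset_left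
        ⟨hw ⟨q, hCZ hq, hqw⟩, mem_Iic.2 le_rfl⟩
    have hCI : C ⊆ Ici w := fun q hq => (hZ (hCZ hq)).resolve_left (hSC q hq)
    rw [inter_eq_left.2 hCI]
    refine finsum_mem_congr rfl fun q hq => hm q ⟨hCZ hq, hCI hq⟩ ?_
    rintro rfl
    exact hwC hq

/-- Collapsing the part of `Z` below `w` to the point `w` does not affect tritangency, provided that
this part is connected and that its multiplicity is attributed to `w`. -/
theorem hasTritangentType_collapse (hZ : Z ⊆ Iic w ∪ Ici w)
    (hS : IsPreconnected (Z ∩ Iic w)) (hw : (Z ∩ Iic w).Nonempty → w ∈ Z) {m m' : ℝ × ℝ → ℤ}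
    (hm : ∀ p ∈ Z ∩ Ici w, p ≠ w → m' p = m p)
    (hfin : (Z ∩ Iic w ∩ Function.support m).Finite)
    (hsum : w ∈ Z → ∑ᶠ p ∈ Z ∩ Iic w, m p = m' w) :
    HasTritangentType (components (Z ∩ Ici w)) (fun Y => ∑ᶠ p ∈ Y, m' p) ↔
      HasTritangentType (components Z) (fun Y => ∑ᶠ p ∈ Y, m p) := by
  have himage : components (Z ∩ Ici w) = (· ∩ Ici w) '' components Z := by
    ext Y
    constructor
    · rintro ⟨p, hp, rfl⟩
      exact ⟨_, ⟨p, hp.1, rfl⟩, connectedComponentIn_inter_Ici hZ hw hp⟩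
    · rintro ⟨C, hC, rfl⟩
      obtain ⟨p, hp, rfl⟩ := exists_mem_Ici_of_mem_components hZ hS hw hC
      exact ⟨p, hp, connectedComponentIn_inter_Ici hZ hw hp⟩
  rw [himage]
  refine hasTritangentType_image_iff ?_ ?_
  · intro C hC C' hC' e
    obtain ⟨p, hp, rfl⟩ := exists_mem_Ici_of_mem_components hZ hS hw hC
    obtain ⟨p', hp', rfl⟩ := exists_mem_Ici_of_mem_components hZ hS hw hC'
    have : p ∈ connectedComponentIn Z p' ∩ Ici w := by
      change p ∈ (fun x => x ∩ Ici w) (connectedComponentIn Z p')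
      rw [← e]; exact ⟨mem_connectedComponentIn hp.1, hp.2⟩
    exact (connectedComponentIn_eq this.1).symm
  · rintro _ ⟨p, -, rfl⟩
    exact finsum_mem_inter_Ici hZ hS hw hm hfin hsum p

end Collapse

/-! ### Symmetries -/

theorem components_image (g : (ℝ × ℝ) ≃ₜ (ℝ × ℝ)) (Z : Set (ℝ × ℝ)) :
    components (g '' Z) = (g '' ·) '' components Z := by
  ext Y
  constructor
  · rintro ⟨_, ⟨p, hp, rfl⟩, rfl⟩
    exact ⟨_, ⟨p, hp, rfl⟩, g.image_connectedComponentIn hp⟩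
  · rintro ⟨_, ⟨p, hp, rfl⟩, rfl⟩
    exact ⟨g p, ⟨p, hp, rfl⟩, g.image_connectedComponentIn hp⟩

/-- A coordinate change `g` of the plane that acts on exponents by `σ` and adds an affine function
to the tropical polynomial transforms the dual cells by `σ`. -/
theorem mem_dualCell_of_monomial {d : ℕ} {c c' : Fin (d + 1) × Fin (d + 1) → ℝ} {p p' : ℝ × ℝ}
    (σ : Equiv.Perm (Fin (d + 1) × Fin (d + 1))) {k : ℝ}
    (h : ∀ a, monomial c' (σ a) p' = monomial c a p + k) {a : Fin (d + 1) × Fin (d + 1)} :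
    σ a ∈ dualCell c' p' ↔ a ∈ dualCell c p := by
  simp only [mem_dualCell]
  rw [← σ.forall_congr_right]
  simp [h]

theorem dualCell_eq_map {d : ℕ} {c c' : Fin (d + 1) × Fin (d + 1) → ℝ} {p p' : ℝ × ℝ}
    (σ : Equiv.Perm (Fin (d + 1) × Fin (d + 1))) {k : ℝ}
    (h : ∀ a, monomial c' (σ a) p' = monomial c a p + k) :
    dualCell c' p' = (dualCell c p).map σ.toEmbedding := by
  ext b
  obtain ⟨a, rfl⟩ := σ.surjective b
  rw [mem_dualCell_of_monomial σ h]
  simp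

theorem mem_curve_of_monomial {d : ℕ} {c c' : Fin (d + 1) × Fin (d + 1) → ℝ} {p p' : ℝ × ℝ}
    (σ : Equiv.Perm (Fin (d + 1) × Fin (d + 1))) {k : ℝ}
    (h : ∀ a, monomial c' (σ a) p' = monomial c a p + k) : p' ∈ curve c' ↔ p ∈ curve c := by
  simp [curve, dualCell_eq_map σ h]

/-- The slopes change by the linear form k₁u₁ + k₂u₂, whose sum over the outgoing directions
vanishes by balancing. Hence g preserves multiplicities as well as components. -/
theorem isTritangent_of_symmetry {c c' : Fin (3 + 1) × Fin (3 + 1) → ℝ} {x x' : Params}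
    (g : (ℝ × ℝ) ≃ₜ (ℝ × ℝ)) (σ : Equiv.Perm (Fin (3 + 1) × Fin (3 + 1)))
    (τ : Equiv.Perm (Fin (1 + 1) × Fin (1 + 1))) (U : Equiv.Perm (ℤ × ℤ)) (k₁ k₂ : ℤ)
    (hc : ∀ p, ∃ k, ∀ a, monomial c' (σ a) (g p) = monomial c a p + k)
    (hx : ∀ p, ∃ k, ∀ a, monomial (lineCoeff x') (τ a) (g p) = monomial (lineCoeff x) a p + k)
    (hU : ∀ D, lineDirections (D.map τ.toEmbedding) = (lineDirections D).map U.toEmbedding)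
    (hσ : ∀ a u, pairing (σ a) (U u) = pairing a u + (k₁ * u.1 + k₂ * u.2))
    (h : IsTritangent c x) : IsTritangent c' x' := by
  have hcurve : line x' ∩ curve c' = g '' (line x ∩ curve c) := by
    ext q
    obtain ⟨p, rfl⟩ := g.surjective q
    obtain ⟨k, hk⟩ := hc p
    obtain ⟨l, hl⟩ := hx p
    rw [g.injective.mem_set_image]
    exact and_congr (mem_curve_of_monomial τ hl) (mem_curve_of_monomial σ hk)
  have hmult : ∀ p, stableMult c' x' (g p) = stableMult c x p := by
    intro p
    obtain ⟨k, hk⟩ := hc p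
    obtain ⟨l, hl⟩ := hx p
    have hslope : ∀ u, outgoingSlope c' (g p) (U u) =
        outgoingSlope c p u + (k₁ * u.1 + k₂ * u.2) := by
      intro u
      obtain ⟨e, he, hmax⟩ := Finset.exists_max_image (dualCell c p) (fun b => pairing b u)
        (dualCell_nonempty c p)
      rw [outgoingSlope_eq he rfl hmax]
      refine outgoingSlope_eq ((mem_dualCell_of_monomial σ hk).2 he) (hσ e u) ?_
      rw [dualCell_eq_map σ hk]
      intro b hb
      obtain ⟨b', hb', rfl⟩ := Finset.mem_map.1 hb
      have := hσ b' u
      have := hmax b' hb'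
      simp only [Equiv.coe_toEmbedding]
      lia
    unfold stableMult
    rw [outgoing_eq, outgoing_eq, dualCell_eq_map τ hl, hU, Finset.sum_map]
    simp only [Equiv.coe_toEmbedding, hslope]
    obtain ⟨h1, h2⟩ := sum_lineDirections (dualCell (lineCoeff x) p)
    rw [Finset.sum_add_distrib, Finset.sum_add_distrib, ← Finset.mul_sum, ← Finset.mul_sum, h1, h2]
    simp
  rw [isTritangent_iff] at h ⊢
  rw [hcurve, components_image]
  refine h.image g.injective.image_injective.injOn fun Y _ => ?_
  rw [finsum_mem_image g.injective.injOn]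
  simp only [hmult]

end

section

/-! ### The coordinate reflections and the transposition -/

/-- Coefficients of the tropical polynomial transformed by `(s, t) ↦ (-s, t)`. -/
def mirrorCoeff (c : Fin (3 + 1) × Fin (3 + 1) → ℝ) : Fin (3 + 1) × Fin (3 + 1) → ℝ :=
  fun a => c (a.1.rev, a.2)

/-- Coefficients of the tropical polynomial transformed by `p ↦ -p`. -/
def negCoeff (c : Fin (3 + 1) × Fin (3 + 1) → ℝ) : Fin (3 + 1) × Fin (3 + 1) → ℝ :=
  fun a => c (a.1.rev, a.2.rev)

/-- The image of a `(1, 1)`-curve under `(s, t) ↦ (-s, t)`. -/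
def mirror (x : Params) : Params := ((-x.1.1, x.1.2), -x.2)

/-- The image of a `(1, 1)`-curve under `p ↦ -p`. -/
def negLine (x : Params) : Params := (-vertexOne x, x.2)

variable {c : Fin (3 + 1) × Fin (3 + 1) → ℝ} {x : Params}

@[simp] theorem mirrorCoeff_mirrorCoeff : mirrorCoeff (mirrorCoeff c) = c := by
  funext a; simp [mirrorCoeff]

@[simp] theorem negCoeff_negCoeff : negCoeff (negCoeff c) = c := by
  funext a; simp [negCoeff]

@[simp] theorem mirror_mirror : mirror (mirror x) = x := by simp [mirror]

@[simp] theorem negLine_negLine : negLine (negLine x) = x := by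
  simp [negLine, vertexOne]

theorem continuous_mirror : Continuous mirror := by unfold mirror; fun_prop

theorem continuous_negLine : Continuous negLine := by unfold negLine vertexOne; fun_prop

theorem cast_rev (i : Fin (3 + 1)) : ((i.rev : ℕ) : ℤ) = 3 - (i : ℕ) := by
  have := Fin.val_rev i; have := i.isLt; lia

theorem cast_rev_real (i : Fin (3 + 1)) : ((i.rev : ℕ) : ℝ) = 3 - (i : ℕ) := by
  have := cast_rev i
  exact_mod_cast this

theorem monomial_mirrorCoeff (a : Fin (3 + 1) × Fin (3 + 1)) (p : ℝ × ℝ) :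
    monomial (mirrorCoeff c) (Fin.revPerm.prodCongr (Equiv.refl _) a) (-p.1, p.2) =
      monomial c a p + -3 * p.1 := by
  simp only [monomial, mirrorCoeff, Equiv.prodCongr_apply, Prod.map, Fin.revPerm_apply,
    Fin.rev_rev, cast_rev_real, Equiv.refl_apply]
  ring

theorem monomial_negCoeff (a : Fin (3 + 1) × Fin (3 + 1)) (p : ℝ × ℝ) :
    monomial (negCoeff c) (Fin.revPerm.prodCongr Fin.revPerm a) (-p) =
      monomial c a p + (-3 * p.1 - 3 * p.2) := by
  simp only [monomial, negCoeff, Equiv.prodCongr_apply, Prod.map, Fin.revPerm_apply,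
    Fin.rev_rev, cast_rev_real, Prod.fst_neg, Prod.snd_neg]
  ring

theorem monomial_comp_swap (a : Fin (3 + 1) × Fin (3 + 1)) (p : ℝ × ℝ) :
    monomial (c ∘ Prod.swap) (Equiv.prodComm _ _ a) p.swap = monomial c a p + 0 := by
  simp only [monomial, Function.comp, Equiv.prodComm_apply, Prod.swap_swap, Prod.fst_swap,
    Prod.snd_swap]
  ring

theorem mem_dualCell_mirrorCoeff {p : ℝ × ℝ} {a : Fin (3 + 1) × Fin (3 + 1)} :
    a ∈ dualCell (mirrorCoeff c) (-p.1, p.2) ↔ (a.1.rev, a.2) ∈ dualCell c p := by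
  have := mem_dualCell_of_monomial (a := (a.1.rev, a.2)) _ fun a => monomial_mirrorCoeff (c := c) a p
  simpa using this

theorem mem_dualCell_negCoeff {p : ℝ × ℝ} {a : Fin (3 + 1) × Fin (3 + 1)} :
    a ∈ dualCell (negCoeff c) (-p) ↔ (a.1.rev, a.2.rev) ∈ dualCell c p := by
  have := mem_dualCell_of_monomial (a := (a.1.rev, a.2.rev)) _ fun a => monomial_negCoeff (c := c) a p
  simpa using this

theorem mem_dualCell_swap {p : ℝ × ℝ} {a : Fin (3 + 1) × Fin (3 + 1)} :
    a ∈ dualCell (c ∘ Prod.swap) p.swap ↔ a.swap ∈ dualCell c p := by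
  have := mem_dualCell_of_monomial (a := a.swap) _ fun a => monomial_comp_swap (c := c) a p
  simpa only [Equiv.prodComm_apply, Prod.swap_swap] using this

theorem forall_exponent {P : Fin (1 + 1) × Fin (1 + 1) → Prop} (h00 : P (0, 0)) (h01 : P (0, 1))
    (h10 : P (1, 0)) (h11 : P (1, 1)) (a : Fin (1 + 1) × Fin (1 + 1)) : P a := by
  obtain ⟨i, j⟩ := a
  fin_cases i <;> fin_cases j <;> assumption

theorem exists_exponent {P : Fin (1 + 1) × Fin (1 + 1) → Prop} :
    (∃ a, P a) ↔ P (0, 0) ∨ P (0, 1) ∨ P (1, 0) ∨ P (1, 1) := by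
  constructor
  · rintro ⟨a, ha⟩
    revert ha
    exact forall_exponent (P := fun a => P a → P (0, 0) ∨ P (0, 1) ∨ P (1, 0) ∨ P (1, 1))
      (by tauto) (by tauto) (by tauto) (by tauto) a
  · rintro (h | h | h | h) <;> exact ⟨_, h⟩

theorem isTritangent_mirror_of (h : IsTritangent c x) :
    IsTritangent (mirrorCoeff c) (mirror x) := by
  refine isTritangent_of_symmetry ((Homeomorph.neg ℝ).prodCongr (Homeomorph.refl ℝ))
    (Fin.revPerm.prodCongr (Equiv.refl _)) (Fin.revPerm.prodCongr (Equiv.refl _))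
    -- The constant -3 comes from (3 - i)(-u₁) = i u₁ - 3u₁.
    ((Equiv.neg ℤ).prodCongr (Equiv.refl ℤ)) (-3) 0
    (fun p => ⟨-3 * p.1, fun a => monomial_mirrorCoeff a p⟩) ?_ (by decide) ?_ h
  -- `lineCoeff` has constant term 0, so the shift must cancel the monomial (1,0), which the
  -- reflection carries to (0,0).
  · refine fun p => ⟨x.1.1 - p.1, ?_⟩
    obtain ⟨h0, h1, h2, h3⟩ := monomial_lineCoeff x p
    obtain ⟨k0, k1, k2, k3⟩ := monomial_lineCoeff (mirror x) (-p.1, p.2)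
    have e1 : min (-x.2) 0 = - max x.2 0 := by rw [← neg_zero, min_neg_neg, neg_zero]
    have e2 : max (-x.2) 0 = - min x.2 0 := by rw [← neg_zero, max_neg_neg, neg_zero]
    simp only [mirror, e1, e2] at k0 k1 k2 k3
    refine forall_exponent ?_ ?_ ?_ ?_
    · rw [h0]; exact k1.trans (by ring)
    · rw [h2]; exact k3.trans (by ring)
    · rw [h1]; exact k0.trans (by ring)
    · rw [h3]; exact k2.trans (by ring)
  · intro a u
    simp only [pairing, Equiv.prodCongr_apply, Prod.map, Fin.revPerm_apply, cast_rev,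
      Equiv.neg_apply, Equiv.refl_apply]
    ring

theorem isTritangent_negLine_of (h : IsTritangent c x) :
    IsTritangent (negCoeff c) (negLine x) := by
  refine isTritangent_of_symmetry (Homeomorph.neg (ℝ × ℝ))
    (Fin.revPerm.prodCongr Fin.revPerm) (Fin.revPerm.prodCongr Fin.revPerm)
    (Equiv.neg (ℤ × ℤ)) (-3) (-3)
    (fun p => ⟨-3 * p.1 - 3 * p.2, fun a => monomial_negCoeff a p⟩) ?_ (by decide) ?_ h
  · refine fun p => ⟨x.1.1 - p.1 + (x.1.2 - p.2) + max x.2 0, ?_⟩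
    obtain ⟨h0, h1, h2, h3⟩ := monomial_lineCoeff x p
    obtain ⟨k0, k1, k2, k3⟩ := monomial_lineCoeff (negLine x) (-p)
    have e : max x.2 0 + min x.2 0 = x.2 := by rw [max_add_min]; simp
    have e' : max x.2 0 - min x.2 0 = |x.2| := by
      rw [max_sub_min_eq_abs]; simp
    simp only [negLine, vertexOne, Prod.fst_neg, Prod.snd_neg] at k0 k1 k2 k3
    refine forall_exponent ?_ ?_ ?_ ?_
    · rw [h0]; exact k3.trans (by linarith)
    · rw [h2]; exact k1.trans (by linarith)
    · rw [h1]; exact k2.trans (by linarith)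
    · rw [h3]; exact k0.trans (by ring)
  · intro a u
    simp only [pairing, Equiv.prodCongr_apply, Prod.map, Fin.revPerm_apply, cast_rev,
      Equiv.neg_apply, Prod.fst_neg, Prod.snd_neg]
    ring

theorem isTritangent_mirror : IsTritangent (mirrorCoeff c) (mirror x) ↔ IsTritangent c x :=
  ⟨fun h => by simpa using isTritangent_mirror_of h, isTritangent_mirror_of⟩

theorem isTritangent_negLine : IsTritangent (negCoeff c) (negLine x) ↔ IsTritangent c x :=
  ⟨fun h => by simpa using isTritangent_negLine_of h, isTritangent_negLine_of⟩

/-- For ℓ < 0 the transposition would exchange which vertex is the lowest, and the formula for the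
parameters would be different. -/
theorem isTritangent_swap (hx : 0 ≤ x.2) (h : IsTritangent c x) :
    IsTritangent (c ∘ Prod.swap) (x.1.swap, x.2) := by
  refine isTritangent_of_symmetry (Homeomorph.prodComm ℝ ℝ)
    (Equiv.prodComm _ _) (Equiv.prodComm _ _) (Equiv.prodComm ℤ ℤ) 0 0
    (fun p => ⟨0, fun a => monomial_comp_swap a p⟩) ?_ (by decide) ?_ h
  · refine fun p => ⟨0, ?_⟩
    obtain ⟨h0, h1, h2, h3⟩ := monomial_lineCoeff x p
    obtain ⟨k0, k1, k2, k3⟩ := monomial_lineCoeff (x.1.swap, x.2) p.swap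
    rw [min_eq_right hx] at h2 k2
    simp only [Prod.fst_swap, Prod.snd_swap] at k0 k1 k2 k3
    refine forall_exponent ?_ ?_ ?_ ?_
    · rw [h0]; exact k0.trans (by ring)
    · rw [h2]; exact k1.trans (by ring)
    · rw [h1]; exact k2.trans (by ring)
    · rw [h3]; exact k3.trans (by ring)
  · intro a u
    simp only [pairing, Equiv.prodComm_apply, Prod.fst_swap, Prod.snd_swap]
    ring

/-! ### The shape of a `(1, 1)`-curve with non-negative edge length -/

theorem mem_line (hx : 0 ≤ x.2) {p : ℝ × ℝ} : p ∈ line x ↔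
    (p.2 = x.1.2 ∧ p.1 ≤ x.1.1) ∨ (p.1 = x.1.1 ∧ p.2 ≤ x.1.2) ∨
    (p.1 - x.1.1 = p.2 - x.1.2 ∧ 0 ≤ p.1 - x.1.1 ∧ p.1 - x.1.1 ≤ x.2) ∨
    (p.2 = x.1.2 + x.2 ∧ x.1.1 + x.2 ≤ p.1) ∨ (p.1 = x.1.1 + x.2 ∧ x.1.2 + x.2 ≤ p.2) := by
  obtain ⟨h0, h1, h2, h3⟩ := monomial_lineCoeff x p
  rw [min_eq_right hx] at h2
  rw [max_eq_left hx] at h3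
  simp only [line, mem_curve, mem_dualCell_lineCoeff, exists_exponent, h0, h1, h2, h3,
    min_eq_right hx, max_eq_left hx, ne_eq]
  constructor
  · rintro (⟨⟨k1, k2, k3, k4⟩, h⟩ | ⟨⟨k1, k2, k3, k4⟩, h⟩ | ⟨⟨k1, k2, k3, k4⟩, h⟩ |
      ⟨⟨k1, k2, k3, k4⟩, h⟩) <;>
    rcases h with (⟨⟨l1, l2, l3, l4⟩, hn⟩ | ⟨⟨l1, l2, l3, l4⟩, hn⟩ |
      ⟨⟨l1, l2, l3, l4⟩, hn⟩ | ⟨⟨l1, l2, l3, l4⟩, hn⟩) <;>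
    first
    | exact absurd trivial hn
    | exact Or.inl ⟨by linarith, by linarith⟩
    | exact Or.inr (Or.inl ⟨by linarith, by linarith⟩)
    | exact Or.inr (Or.inr (Or.inl ⟨by linarith, by linarith, by linarith⟩))
    | exact Or.inr (Or.inr (Or.inr (Or.inl ⟨by linarith, by linarith⟩)))
    | exact Or.inr (Or.inr (Or.inr (Or.inr ⟨by linarith, by linarith⟩)))
  · rintro (⟨k1, k2⟩ | ⟨k1, k2⟩ | ⟨k1, k2, k3⟩ | ⟨k1, k2⟩ | ⟨k1, k2⟩)
    · refine Or.inl ⟨?_, Or.inr (Or.inl ⟨?_, by decide⟩)⟩ <;>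
        refine ⟨?_, ?_, ?_, ?_⟩ <;> linarith
    · refine Or.inl ⟨?_, Or.inr (Or.inr (Or.inl ⟨?_, by decide⟩))⟩ <;>
        refine ⟨?_, ?_, ?_, ?_⟩ <;> linarith
    · refine Or.inr (Or.inl ⟨?_, Or.inr (Or.inr (Or.inl ⟨?_, by decide⟩))⟩) <;>
        refine ⟨?_, ?_, ?_, ?_⟩ <;> linarith
    · refine Or.inr (Or.inr (Or.inl ⟨?_, Or.inr (Or.inr (Or.inr ⟨?_, by decide⟩))⟩)) <;>
        refine ⟨?_, ?_, ?_, ?_⟩ <;> linarith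
    · refine Or.inr (Or.inl ⟨?_, Or.inr (Or.inr (Or.inr ⟨?_, by decide⟩))⟩) <;>
        refine ⟨?_, ?_, ?_, ?_⟩ <;> linarith

end

section

variable {c : Fin (3 + 1) × Fin (3 + 1) → ℝ} {x : Params}

/-! ### Multiplicities along the lower legs and the edge -/

theorem lineDirections_values :
    lineDirections {(0, 0), (0, 1)} = {(1, 0), (-1, 0)} ∧
    lineDirections {(0, 0), (1, 0)} = {(0, 1), (0, -1)} ∧
    lineDirections {(1, 0), (0, 1)} = {(1, 1), (-1, -1)} ∧
    lineDirections {(0, 0), (1, 0), (0, 1)} = {(-1, 0), (0, -1), (1, 1)} ∧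
    lineDirections {(1, 0), (0, 1), (1, 1)} = {(-1, -1), (1, 0), (0, 1)} ∧
    lineDirections {(0, 0), (1, 0), (0, 1), (1, 1)} = {(-1, 0), (0, -1), (1, 0), (0, 1)} := by
  decide

theorem dualCell_lineCoeff_eq {p : ℝ × ℝ} {D : Finset (Fin (1 + 1) × Fin (1 + 1))}
    (h00 : (0, 0) ∈ D ↔ (0, 0) ∈ dualCell (lineCoeff x) p)
    (h01 : (0, 1) ∈ D ↔ (0, 1) ∈ dualCell (lineCoeff x) p)
    (h10 : (1, 0) ∈ D ↔ (1, 0) ∈ dualCell (lineCoeff x) p)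
    (h11 : (1, 1) ∈ D ↔ (1, 1) ∈ dualCell (lineCoeff x) p) :
    dualCell (lineCoeff x) p = D :=
  Finset.ext fun a => (forall_exponent (P := fun a => a ∈ D ↔ a ∈ dualCell (lineCoeff x) p)
    h00 h01 h10 h11 a).symm

/-- Explicit membership in the dual cell of a `(1, 1)`-curve with non-negative edge length. -/
theorem mem_dualCell_lineCoeff_of_nonneg (hx : 0 ≤ x.2) (p : ℝ × ℝ) :
    ((0, 0) ∈ dualCell (lineCoeff x) p ↔ p.1 ≤ x.1.1 ∧ p.2 ≤ x.1.2) ∧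
    ((0, 1) ∈ dualCell (lineCoeff x) p ↔
      x.1.2 ≤ p.2 ∧ p.1 - x.1.1 ≤ p.2 - x.1.2 ∧ p.1 - x.1.1 ≤ x.2) ∧
    ((1, 0) ∈ dualCell (lineCoeff x) p ↔
      x.1.1 ≤ p.1 ∧ p.2 - x.1.2 ≤ p.1 - x.1.1 ∧ p.2 - x.1.2 ≤ x.2) ∧
    ((1, 1) ∈ dualCell (lineCoeff x) p ↔ x.1.1 + x.2 ≤ p.1 ∧ x.1.2 + x.2 ≤ p.2) := by
  obtain ⟨h0, h1, h2, h3⟩ := monomial_lineCoeff x p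
  simp only [mem_dualCell_lineCoeff, h0, h1, h2, h3, min_eq_right hx, max_eq_left hx]
  refine ⟨⟨?_, ?_⟩, ⟨?_, ?_⟩, ⟨?_, ?_⟩, ⟨?_, ?_⟩⟩
  · rintro ⟨k1, k2, k3, k4⟩; constructor <;> linarith
  · rintro ⟨k1, k2⟩; refine ⟨?_, ?_, ?_, ?_⟩ <;> linarith
  · rintro ⟨k1, k2, k3, k4⟩; refine ⟨?_, ?_, ?_⟩ <;> linarith
  · rintro ⟨k1, k2, k3⟩; refine ⟨?_, ?_, ?_, ?_⟩ <;> linarith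
  · rintro ⟨k1, k2, k3, k4⟩; refine ⟨?_, ?_, ?_⟩ <;> linarith
  · rintro ⟨k1, k2, k3⟩; refine ⟨?_, ?_, ?_, ?_⟩ <;> linarith
  · rintro ⟨k1, k2, k3, k4⟩; constructor <;> linarith
  · rintro ⟨k1, k2⟩; refine ⟨?_, ?_, ?_, ?_⟩ <;> linarith

theorem stableMult_leftLeg (hx : 0 ≤ x.2) {p : ℝ × ℝ} (h1 : p.1 < x.1.1) (h2 : p.2 = x.1.2) :
    stableMult c x p = outgoingSlope c p (1, 0) + outgoingSlope c p (-1, 0) := by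
  have hD : dualCell (lineCoeff x) p = {(0, 0), (0, 1)} := by
    obtain ⟨k0, k1, k2, k3⟩ := mem_dualCell_lineCoeff_of_nonneg hx p
    refine dualCell_lineCoeff_eq ?_ ?_ ?_ ?_ <;> simp only [k0, k1, k2, k3]
    · exact iff_of_true (by decide) ⟨h1.le, h2.le⟩
    · exact iff_of_true (by decide) ⟨h2.ge, by linarith, by linarith⟩
    · exact iff_of_false (by decide) fun h => by linarith [h.1]
    · exact iff_of_false (by decide) fun h => by linarith [h.1]
  rw [stableMult, outgoing_eq, hD, lineDirections_values.1, Finset.sum_pair (by decide)]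

theorem stableMult_lowerLeg (hx : 0 ≤ x.2) {p : ℝ × ℝ} (h1 : p.1 = x.1.1) (h2 : p.2 < x.1.2) :
    stableMult c x p = outgoingSlope c p (0, 1) + outgoingSlope c p (0, -1) := by
  have hD : dualCell (lineCoeff x) p = {(0, 0), (1, 0)} := by
    obtain ⟨k0, k1, k2, k3⟩ := mem_dualCell_lineCoeff_of_nonneg hx p
    refine dualCell_lineCoeff_eq ?_ ?_ ?_ ?_ <;> simp only [k0, k1, k2, k3]
    · exact iff_of_true (by decide) ⟨h1.le, h2.le⟩
    · exact iff_of_false (by decide) fun h => by linarith [h.1]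
    · exact iff_of_true (by decide) ⟨h1.ge, by linarith, by linarith⟩
    · exact iff_of_false (by decide) fun h => by linarith [h.2]
  rw [stableMult, outgoing_eq, hD, lineDirections_values.2.1, Finset.sum_pair (by decide)]

theorem stableMult_edge {p : ℝ × ℝ} {t : ℝ} (h0 : 0 < t) (ht : t < x.2) (hp : p = move x.1 t (1, 1)) :
    stableMult c x p = outgoingSlope c p (1, 1) + outgoingSlope c p (-1, -1) := by
  have h1 : p.1 = x.1.1 + t := by simp [hp, move]
  have h2 : p.2 = x.1.2 + t := by simp [hp, move]
  have hD : dualCell (lineCoeff x) p = {(1, 0), (0, 1)} := by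
    obtain ⟨k0, k1, k2, k3⟩ := mem_dualCell_lineCoeff_of_nonneg (h0.trans ht).le p
    refine dualCell_lineCoeff_eq ?_ ?_ ?_ ?_ <;> simp only [k0, k1, k2, k3]
    · exact iff_of_false (by decide) fun h => by linarith [h.1]
    · exact iff_of_true (by decide) ⟨by linarith, by linarith, by linarith⟩
    · exact iff_of_true (by decide) ⟨by linarith, by linarith, by linarith⟩
    · exact iff_of_false (by decide) fun h => by linarith [h.1]
  rw [stableMult, outgoing_eq, hD, lineDirections_values.2.2.1, Finset.sum_pair (by decide)]

theorem stableMult_vertexZero (hx : 0 < x.2) :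
    stableMult c x x.1 = outgoingSlope c x.1 (-1, 0) + outgoingSlope c x.1 (0, -1) +
      outgoingSlope c x.1 (1, 1) := by
  have hD : dualCell (lineCoeff x) x.1 = {(0, 0), (1, 0), (0, 1)} := by
    obtain ⟨k0, k1, k2, k3⟩ := mem_dualCell_lineCoeff_of_nonneg hx.le x.1
    refine dualCell_lineCoeff_eq ?_ ?_ ?_ ?_ <;> simp only [k0, k1, k2, k3]
    · exact iff_of_true (by decide) ⟨le_rfl, le_rfl⟩
    · exact iff_of_true (by decide) ⟨by linarith, by linarith, by linarith⟩
    · exact iff_of_true (by decide) ⟨by linarith, by linarith, by linarith⟩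
    · exact iff_of_false (by decide) fun h => by linarith [h.1]
  rw [stableMult, outgoing_eq, hD, lineDirections_values.2.2.2.1, Finset.sum_insert (by decide),
    Finset.sum_pair (by decide), add_assoc]

/-! ### Parity along a leg -/

/-- The slope `k` is crossed at the point with first coordinate `s` and second coordinate `y`. -/
def Crosses (c : Fin (3 + 1) × Fin (3 + 1) → ℝ) (y : ℝ) (k : ℕ) (s : ℝ) : Prop :=
  (∃ b ∈ dualCell c (s, y), (b.1 : ℕ) < k) ∧ ∃ b ∈ dualCell c (s, y), k ≤ (b.1 : ℕ)

/-- On a horizontal line the polynomial is convex, so its slopes only increase and each value is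
passed once. -/
theorem Crosses.unique {y s s' : ℝ} {k : ℕ} (h : Crosses c y k s) (h' : Crosses c y k s') :
    s = s' := by
  wlog hlt : s < s' generalizing s s'
  · rcases lt_trichotomy s s' with h1 | h1 | h1
    · exact this h h' h1
    · exact h1
    · exact (this h' h h1).symm
  obtain ⟨b, hb, hkb⟩ := h.2
  obtain ⟨e, he, hke⟩ := h'.1
  have h1 := mem_dualCell.1 hb e
  have h2 := mem_dualCell.1 he b
  simp only [monomial] at h1 h2
  have h3 : ((e.1 : ℕ) : ℝ) < ((b.1 : ℕ) : ℝ) := by exact_mod_cast hke.trans_le hkb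
  nlinarith

theorem isClosed_setOf_mem_dualCell {d : ℕ} (c : Fin (d + 1) × Fin (d + 1) → ℝ)
    (a : Fin (d + 1) × Fin (d + 1)) : IsClosed {p | a ∈ dualCell c p} := by
  simp only [mem_dualCell, ofPred_forall]
  refine isClosed_iInter fun b => isClosed_le ?_ ?_ <;> unfold monomial <;> fun_prop

/-- Far to the left, the monomials of slope 0 dominate; this gives the low-slope end for
`exists_crosses`. -/
theorem exists_mem_dualCell_fst_eq_zero (c : Fin (3 + 1) × Fin (3 + 1) → ℝ) (y s₀ : ℝ) :
    ∃ s ≤ s₀, ∃ b ∈ dualCell c (s, y), b.1 = 0 := by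
  have h : ∀ᶠ s : ℝ in atBot, ∀ b : Fin (3 + 1) × Fin (3 + 1), b.1 ≠ 0 →
      monomial c b (s, y) ≤ monomial c (0, 0) (s, y) := by
    rw [eventually_all]
    intro b
    by_cases hb : b.1 = 0
    · simp [hb]
    have hb' : (1 : ℝ) ≤ ((b.1 : ℕ) : ℝ) := by
      exact_mod_cast Nat.one_le_iff_ne_zero.2 fun h => hb (Fin.ext h)
    filter_upwards [eventually_le_atBot (0 : ℝ),
      eventually_le_atBot (c (0, 0) - c b - ((b.2 : ℕ) : ℝ) * y)] with s hs0 hs _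
    simp only [monomial, Fin.val_zero, Nat.cast_zero, zero_mul, add_zero]
    nlinarith
  obtain ⟨s, hs, hs'⟩ := (h.and (eventually_le_atBot s₀)).exists
  refine ⟨s, hs', ?_⟩
  obtain ⟨e, he⟩ := dualCell_nonempty c (s, y)
  by_cases he0 : e.1 = 0
  · exact ⟨e, he, he0⟩
  · exact ⟨(0, 0), mem_dualCell.2 fun b => (mem_dualCell.1 he b).trans (hs e he0), rfl⟩

/-- To the left of a point of the chamber of `a`, all slopes up to `a.1` are crossed. -/
theorem exists_crosses {p : ℝ × ℝ} {a : Fin (3 + 1) × Fin (3 + 1)} (ha : dualCell c p = {a})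
    {k : ℕ} (hk : 1 ≤ k) (hka : k ≤ (a.1 : ℕ)) : ∃ s < p.1, Crosses c p.2 k s := by
  have hcl : ∀ P : Fin (3 + 1) × Fin (3 + 1) → Prop,
      IsClosed {s : ℝ | ∃ b ∈ dualCell c (s, p.2), P b} := by
    intro P
    have : {s : ℝ | ∃ b ∈ dualCell c (s, p.2), P b} =
        ⋃ b ∈ {b | P b}, (fun s : ℝ => (s, p.2)) ⁻¹' {q | b ∈ dualCell c q} := by
      ext s; simp [and_comm]
    rw [this]
    exact (toFinite _).isClosed_biUnion fun b _ =>
      (isClosed_setOf_mem_dualCell c b).preimage (by fun_prop)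
  obtain ⟨s₀, hs₀, b₀, hb₀, hb₀'⟩ := exists_mem_dualCell_fst_eq_zero c p.2 p.1
  -- The ray is covered by two non-empty closed sets, where some maximal exponent has slope below k,
  -- respectively at least k. They meet because the ray is connected.
  obtain ⟨s, hs, h1, h2⟩ := isPreconnected_closed_iff.1 (isPreconnected_Iic (a := p.1))
    _ _ (hcl fun b => (b.1 : ℕ) < k) (hcl fun b => k ≤ (b.1 : ℕ)) (by
      intro s _
      obtain ⟨b, hb⟩ := dualCell_nonempty c (s, p.2)
      rcases lt_or_ge (b.1 : ℕ) k with h | h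
      · exact Or.inl ⟨b, hb, h⟩
      · exact Or.inr ⟨b, hb, h⟩)
    ⟨s₀, hs₀, b₀, hb₀, by rw [hb₀']; exact hk⟩ ⟨p.1, mem_Iic.2 le_rfl, a, by simp [ha], hka⟩
  refine ⟨s, lt_of_le_of_ne hs ?_, h1, h2⟩
  rintro rfl
  obtain ⟨b, hb, hbk⟩ := h1
  rw [Prod.mk.eta, ha, Finset.mem_singleton] at hb
  subst hb
  exact absurd hka hbk.not_ge

theorem Crosses.le {p : ℝ × ℝ} {a : Fin (3 + 1) × Fin (3 + 1)} (ha : a ∈ dualCell c p)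
    {k : ℕ} {s : ℝ} (hs : s < p.1) (h : Crosses c p.2 k s) : k ≤ (a.1 : ℕ) := by
  obtain ⟨b, hb, hkb⟩ := h.2
  refine hkb.trans ?_
  by_contra! hlt
  have h1 := mem_dualCell.1 hb a
  have h2 := mem_dualCell.1 ha b
  simp only [monomial] at h1 h2
  have h3 : ((a.1 : ℕ) : ℝ) < ((b.1 : ℕ) : ℝ) := by exact_mod_cast hlt
  nlinarith

open Classical in
/-- The multiplicity at a point of the left leg counts the slopes that are crossed there. -/
theorem slope_add_slope_eq_card {y s : ℝ} {n : ℕ} (hn : ∀ k, Crosses c y k s → k ≤ n) :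
    outgoingSlope c (s, y) (1, 0) + outgoingSlope c (s, y) (-1, 0) =
      (((Finset.Icc 1 n).filter fun k => Crosses c y k s).card : ℤ) := by
  obtain ⟨e, he, hmax⟩ := Finset.exists_max_image (dualCell c (s, y)) (fun b => (b.1 : ℕ))
    (dualCell_nonempty c (s, y))
  obtain ⟨f, hf, hmin⟩ := Finset.exists_min_image (dualCell c (s, y)) (fun b => (b.1 : ℕ))
    (dualCell_nonempty c (s, y))
  rw [outgoingSlope_eq (n := ((e.1 : ℕ) : ℤ)) he (by simp [pairing])
      (fun b hb => by simpa [pairing] using hmax b hb),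
    outgoingSlope_eq (n := -((f.1 : ℕ) : ℤ)) hf (by simp [pairing])
      (fun b hb => by simpa [pairing] using hmin b hb)]
  have hfe : (f.1 : ℕ) ≤ (e.1 : ℕ) := hmin e he
  -- The two one-sided slopes add up to the jump of the derivative, which is the number of integers
  -- strictly above the least slope and up to the greatest.
  have : (Finset.Icc 1 n).filter (fun k => Crosses c y k s) =
      Finset.Ioc (f.1 : ℕ) (e.1 : ℕ) := by
    ext k
    rw [Finset.mem_filter, Finset.mem_Ioc, Finset.mem_Icc]
    constructor
    · rintro ⟨-, ⟨b, hb, h1⟩, ⟨b', hb', h2⟩⟩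
      exact ⟨(hmin b hb).trans_lt h1, h2.trans (hmax b' hb')⟩
    · rintro ⟨h1, h2⟩
      have hk : Crosses c y k s := ⟨⟨f, hf, h1⟩, ⟨e, he, h2⟩⟩
      exact ⟨⟨by lia, hn k hk⟩, hk⟩
  rw [this, Nat.card_Ioc, Nat.cast_sub hfe]
  ring

end

section

variable {c : Fin (3 + 1) × Fin (3 + 1) → ℝ} {x : Params}

/-- In the interior of a segment, only those exponents are maximal that are maximal at both
end points, provided that there are any. -/
theorem mem_dualCell_move_of_mem {d : ℕ} {c : Fin (d + 1) × Fin (d + 1) → ℝ} {p : ℝ × ℝ}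
    {a b : Fin (d + 1) × Fin (d + 1)} {u : ℤ × ℤ} {s t : ℝ} (ha : a ∈ dualCell c p)
    (ha' : a ∈ dualCell c (move p s u)) (ht : 0 < t) (hts : t < s) :
    b ∈ dualCell c (move p t u) ↔ b ∈ dualCell c p ∧ b ∈ dualCell c (move p s u) := by
  have key : ∀ e, (s - t) * (monomial c a p - monomial c e p) +
      t * (monomial c a (move p s u) - monomial c e (move p s u)) =
      s * (monomial c a (move p t u) - monomial c e (move p t u)) := by
    intro e; simp only [monomial_move]; ring
  have h1 : ∀ e, 0 ≤ monomial c a p - monomial c e p :=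
    fun e => sub_nonneg.2 (mem_dualCell.1 ha e)
  have h2 : ∀ e, 0 ≤ monomial c a (move p s u) - monomial c e (move p s u) :=
    fun e => sub_nonneg.2 (mem_dualCell.1 ha' e)
  have hs : 0 < s := ht.trans hts
  have ha'' : a ∈ dualCell c (move p t u) := mem_dualCell.2 fun e => by
    have := key e
    have := mul_nonneg (sub_nonneg.2 hts.le) (h1 e)
    have := mul_nonneg ht.le (h2 e)
    exact sub_nonneg.1 ((mul_nonneg_iff_of_pos_left hs).1 (by linarith))
  rw [mem_dualCell_iff_eq ha, mem_dualCell_iff_eq ha', mem_dualCell_iff_eq ha'']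
  have k := key b
  have k1 := mul_nonneg (sub_nonneg.2 hts.le) (h1 b)
  have k2 := mul_nonneg ht.le (h2 b)
  constructor
  · intro h
    rw [h, sub_self, mul_zero] at k
    have e1 : (s - t) * (monomial c a p - monomial c b p) = 0 := by linarith
    have e2 : t * (monomial c a (move p s u) - monomial c b (move p s u)) = 0 := by linarith
    have e1' := (mul_eq_zero.1 e1).resolve_left (by linarith)
    have e2' := (mul_eq_zero.1 e2).resolve_left (by linarith)
    constructor <;> linarith
  · rintro ⟨e1, e2⟩
    rw [e1, e2, sub_self, sub_self, mul_zero, mul_zero, add_zero] at k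
    have := (mul_eq_zero.1 k.symm).resolve_left hs.ne'
    linarith

theorem connectedComponentIn_subset_of_separated {Z U V : Set (ℝ × ℝ)} (hU : IsOpen U)
    (hV : IsOpen V) (hZ : Z ⊆ U ∪ V) (hUV : Z ∩ (U ∩ V) = ∅) {p : ℝ × ℝ} (hp : p ∈ Z)
    (hpU : p ∈ U) : connectedComponentIn Z p ⊆ U := by
  intro q hq
  by_contra hqU
  have hqV : q ∈ V := (hZ (connectedComponentIn_subset _ _ hq)).resolve_left hqU
  obtain ⟨r, hr, hr'⟩ := isPreconnected_connectedComponentIn U V hU hV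
    ((connectedComponentIn_subset _ _).trans hZ) ⟨p, mem_connectedComponentIn hp, hpU⟩ ⟨q, hq, hqV⟩
  have : r ∈ Z ∩ (U ∩ V) := ⟨connectedComponentIn_subset _ _ hr, hr'⟩
  rw [hUV] at this
  exact this

theorem IsTritangent.even_of_mem (h : IsTritangent c x) {p : ℝ × ℝ} (hp : p ∈ line x ∩ curve c) :
    Even (∑ᶠ q ∈ connectedComponentIn (line x ∩ curve c) p, stableMult c x q) :=
  HasTritangentType.even (isTritangent_iff.1 h) ⟨p, hp, rfl⟩

/-- If the lower vertex lies off the curve, then a component that meets the left leg lies in it. -/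
theorem component_subset_leftLeg (hx : 0 ≤ x.2) (hv : x.1 ∉ curve c) {p : ℝ × ℝ}
    (hp : p ∈ line x ∩ curve c) (hp1 : p.1 < x.1.1) :
    ∀ q ∈ connectedComponentIn (line x ∩ curve c) p, q.1 < x.1.1 ∧ q.2 = x.1.2 := by
  -- The sets U and V are disjoint on Λ, and together they omit only v₀, which is off Γ.
  have hsub := connectedComponentIn_subset_of_separated (Z := line x ∩ curve c)
    (U := {q | q.1 < x.1.1}) (V := {q | x.1.1 < q.1} ∪ {q | q.2 ≠ x.1.2})
    (isOpen_lt continuous_fst continuous_const)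
    ((isOpen_lt continuous_const continuous_fst).union (isOpen_ne_fun continuous_snd continuous_const))
    ?_ ?_ hp hp1
  · intro q hq
    have h1 : q.1 < x.1.1 := hsub hq
    refine ⟨h1, ?_⟩
    rcases (mem_line hx).1 (connectedComponentIn_subset _ _ hq).1 with
      ⟨k1, k2⟩ | ⟨k1, k2⟩ | ⟨k1, k2, k3⟩ | ⟨k1, k2⟩ | ⟨k1, k2⟩ <;> linarith
  · rintro q ⟨hq, hqc⟩
    by_contra hcon
    simp only [mem_union, mem_ofPred_eq, not_or, not_lt, not_not] at hcon
    obtain ⟨l1, l2, l3⟩ := hcon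
    have : q = x.1 := Prod.ext (le_antisymm l2 l1) l3
    exact hv (this ▸ hqc)
  · ext q
    simp only [mem_inter_iff, mem_union, mem_ofPred_eq, mem_empty_iff_false, iff_false]
    rintro ⟨⟨hq, -⟩, h1, h2⟩
    rcases (mem_line hx).1 hq with ⟨k1, k2⟩ | ⟨k1, k2⟩ | ⟨k1, k2, k3⟩ | ⟨k1, k2⟩ | ⟨k1, k2⟩ <;>
      rcases h2 with h2 | h2 <;> first | linarith | exact h2 (by linarith)

/-- If the lower vertex lies in the chamber of `a`, then the left leg has intersection
multiplicity `a.1`, which is even for a tritangent curve. -/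
theorem even_fst_of_dualCell_eq_singleton (hx : 0 ≤ x.2) (h : IsTritangent c x)
    {a : Fin (3 + 1) × Fin (3 + 1)} (ha : dualCell c x.1 = {a}) : Even (a.1 : ℕ) := by
  classical
  set n := (a.1 : ℕ) with hn
  have hex : ∀ k, ∃ s, k ∈ Finset.Icc 1 n → s < x.1.1 ∧ Crosses c x.1.2 k s := by
    intro k
    by_cases hk : k ∈ Finset.Icc 1 n
    · obtain ⟨h1, h2⟩ := Finset.mem_Icc.1 hk
      obtain ⟨s, hs⟩ := exists_crosses ha h1 h2
      exact ⟨s, fun _ => hs⟩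
    · exact ⟨0, fun h => absurd h hk⟩
  choose s hs using hex
  -- The points where the slopes 1, …, n are crossed; they may coincide, and the multiplicity of a
  -- point of the leg is the number of k mapped to it.
  set P : ℕ → ℝ × ℝ := fun k => (s k, x.1.2) with hP
  set Z := line x ∩ curve c with hZ
  have hPZ : ∀ k ∈ Finset.Icc 1 n, P k ∈ Z := by
    intro k hk
    obtain ⟨h1, ⟨b, hb, h2⟩, ⟨e, he, h3⟩⟩ := hs k hk
    refine ⟨(mem_line hx).2 (Or.inl ⟨rfl, h1.le⟩), mem_curve.2 ⟨b, hb, e, he, ?_⟩⟩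
    rintro rfl
    exact absurd h2 h3.not_gt
  have hmult : ∀ q : ℝ × ℝ, q.1 < x.1.1 → q.2 = x.1.2 → stableMult c x q =
      ∑ k ∈ Finset.Icc 1 n, if P k = q then 1 else 0 := by
    rintro ⟨q1, q2⟩ hq1 rfl
    rw [stableMult_leftLeg hx hq1 rfl, slope_add_slope_eq_card (n := n), ← Finset.natCast_card_filter]
    · congr 2
      refine Finset.filter_congr fun k hk => ?_
      constructor
      · intro hk'
        exact Prod.ext ((hs k hk).2.unique hk') rfl
      · intro e
        have : s k = q1 := congrArg Prod.fst e
        rw [← this]; exact (hs k hk).2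
    · intro k hk
      exact Crosses.le (p := x.1) (by simp [ha]) hq1 hk
  -- The number of k with `P k` in a given component is the multiplicity of that component, hence
  -- even.
  have hsum : ∀ l ∈ Finset.Icc 1 n, Even (∑ k ∈ Finset.Icc 1 n,
      if P k ∈ connectedComponentIn Z (P l) then (1 : ℤ) else 0) := by
    intro l hl
    set C := connectedComponentIn Z (P l) with hC
    have hCleg := component_subset_leftLeg hx (notMem_curve_of_dualCell_eq_singleton ha)
      (hPZ l hl) (hs l hl).1
    set t := ((Finset.Icc 1 n).image P).filter (· ∈ C) with ht
    have key : ∑ᶠ q ∈ C, stableMult c x q = ∑ q ∈ t, stableMult c x q := by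
      refine finsum_mem_eq_sum_of_subset _ ?_ ?_
      · rintro q ⟨hq, hq'⟩
        rw [Function.mem_support, hmult q (hCleg q hq).1 (hCleg q hq).2] at hq'
        obtain ⟨k, hk, hk'⟩ := Finset.exists_ne_zero_of_sum_ne_zero hq'
        simp only [ne_eq, ite_eq_right_iff, one_ne_zero, imp_false, not_not] at hk'
        rw [ht, Finset.coe_filter]
        exact ⟨Finset.mem_image.2 ⟨k, hk, hk'⟩, hq⟩
      · intro q hq
        exact (Finset.mem_filter.1 hq).2
    have h2 := h.even_of_mem (hPZ l hl)
    rw [key] at h2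
    convert h2 using 1
    rw [Finset.sum_congr rfl fun q hq => hmult q (hCleg q (Finset.mem_filter.1 hq).2).1
      (hCleg q (Finset.mem_filter.1 hq).2).2, Finset.sum_comm]
    refine Finset.sum_congr rfl fun k hk => ?_
    rw [Finset.sum_ite_eq]
    refine if_congr ?_ rfl rfl
    exact ⟨fun h => Finset.mem_filter.2 ⟨Finset.mem_image_of_mem _ hk, h⟩,
      fun h => (Finset.mem_filter.1 h).2⟩
  have hself : ∀ l ∈ Finset.Icc 1 n, P l ∈ connectedComponentIn Z (P l) :=
    fun l hl => mem_connectedComponentIn (hPZ l hl)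
  have hsymm : ∀ k ∈ Finset.Icc 1 n, ∀ l, P k ∈ connectedComponentIn Z (P l) →
      connectedComponentIn Z (P k) = connectedComponentIn Z (P l) :=
    fun k _ l hkl => (connectedComponentIn_eq hkl).symm
  -- Lying in the same component partitions {1, …, n} into classes of even size. As n ≤ 3, only n =
  -- 1 and n = 3 have to be excluded.
  have hlt : n < 4 := a.1.isLt
  clear_value n
  interval_cases n
  · decide
  · have := hsum 1 (by simp)
    simp only [Finset.Icc_self, Finset.sum_singleton, hself 1 (by simp), if_true] at this
    exact absurd this (by decide)
  · decide
  · exfalso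
    have hI : Finset.Icc 1 3 = {1, 2, 3} := by decide
    have m1 : 1 ∈ Finset.Icc 1 3 := by decide
    have m2 : 2 ∈ Finset.Icc 1 3 := by decide
    have m3 : 3 ∈ Finset.Icc 1 3 := by decide
    have s1 := hsum 1 m1
    have s2 := hsum 2 m2
    have s3 := hsum 3 m3
    rw [hI, Finset.sum_insert (by decide), Finset.sum_insert (by decide),
      Finset.sum_singleton] at s1 s2 s3
    rw [if_pos (hself 1 m1)] at s1
    rw [if_pos (hself 2 m2)] at s2
    rw [if_pos (hself 3 m3)] at s3
    by_cases h2 : P 2 ∈ connectedComponentIn Z (P 1)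
    · rw [hsymm 2 m2 1 h2, if_pos (hself 1 m1)] at s2
      by_cases h3 : P 3 ∈ connectedComponentIn Z (P 1)
      · rw [if_pos h2, if_pos h3] at s1
        exact absurd s1 (by decide)
      · have n1 : P 1 ∉ connectedComponentIn Z (P 3) := fun h' => h3 (by
          rw [hsymm 1 m1 3 h']; exact hself 3 m3)
        have n2 : P 2 ∉ connectedComponentIn Z (P 3) := fun h' => h3 (by
          rw [← hsymm 2 m2 1 h2, hsymm 2 m2 3 h']; exact hself 3 m3)
        rw [if_neg n1, if_neg n2] at s3
        exact absurd s3 (by decide)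
    · have n1 : P 1 ∉ connectedComponentIn Z (P 2) := fun h' => h2 (by
        rw [hsymm 1 m1 2 h']; exact hself 2 m2)
      rw [if_neg n1] at s2
      by_cases h3 : P 3 ∈ connectedComponentIn Z (P 2)
      · have n3 : P 3 ∉ connectedComponentIn Z (P 1) := fun h' => n1 (by
          rw [← hsymm 3 m3 2 h3, hsymm 3 m3 1 h']; exact hself 1 m1)
        rw [if_neg h2, if_neg n3] at s1
        exact absurd s1 (by decide)
      · rw [if_neg h3] at s2
        exact absurd s2 (by decide)

/-! ### The position of the lower vertex -/

/-- If `ℓ > 0`, the lower vertex of a tritangent curve is not in an open cell dual to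
`(1, 0)` or to the edge between `(0, 0)` and `(1, 0)`. -/
theorem not_dualCell_vertexZero_subset (hx : 0 < x.2) (h : IsTritangent c x)
    (h10 : (1, 0) ∈ dualCell c x.1) (hsub : ∀ a ∈ dualCell c x.1, a = (0, 0) ∨ a = (1, 0)) :
    False := by
  classical
  by_cases h00 : (0, 0) ∈ dualCell c x.1
  swap
  · have : dualCell c x.1 = {(1, 0)} := by
      ext a
      rw [Finset.mem_singleton]
      exact ⟨fun ha => (hsub a ha).resolve_left fun e => h00 (e ▸ ha), fun e => e ▸ h10⟩
    exact absurd (even_fst_of_dualCell_eq_singleton hx.le h this) (by decide)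
  -- What remains is v₀ on the open edge dual to {(0,0), (1,0)}. Going up the edge of Λ, the
  -- exponent (1,0) gains on (0,0), so Λ leaves Γ at once.
  obtain ⟨ε, hε, hε0, hεx⟩ := ((eventually_mem_dualCell_move c x.1 (1, 1)).and
    (Ioo_mem_nhdsGT hx : ∀ᶠ t : ℝ in 𝓝[>] 0, t ∈ Ioo 0 x.2)).exists
  have hεd : ∀ b, b ∈ dualCell c (move x.1 ε (1, 1)) → b = (1, 0) := by
    intro b hb
    obtain ⟨h1, h2⟩ := (hε b).1 hb
    rcases hsub b h1 with rfl | rfl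
    · exact absurd (h2 _ h10) (by decide)
    · rfl
  have hεc : (1, 0) ∈ dualCell c (move x.1 ε (1, 1)) := by
    obtain ⟨b, hb⟩ := dualCell_nonempty c (move x.1 ε (1, 1))
    exact hεd b hb ▸ hb
  have hoff : ∀ t : ℝ, 0 < t → t ≤ ε → move x.1 t (1, 1) ∉ curve c := by
    intro t ht htε
    have : ∀ b ∈ dualCell c (move x.1 t (1, 1)), b = (1, 0) := by
      intro b hb
      rcases htε.lt_or_eq with hlt | rfl
      · exact hεd b ((mem_dualCell_move_of_mem h10 hεc ht hlt).1 hb).2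
      · exact hεd b hb
    rw [mem_curve]
    rintro ⟨b, hb, e, he, hbe⟩
    exact hbe ((this b hb).trans (this e he).symm)
  have hleft : ∀ t : ℝ, 0 < t → move x.1 t (-1, 0) ∉ curve c := by
    intro t ht
    have key : ∀ b, b ∈ dualCell c (move x.1 t (-1, 0)) → b = (0, 0) := by
      intro b hb
      obtain ⟨h1, h2⟩ := (mem_dualCell_move_of_forall_le h00 (by decide) ht).1 hb
      rcases hsub b h1 with rfl | rfl
      · rfl
      · exact absurd h2 (by decide)
    rw [mem_curve]
    rintro ⟨b, hb, e, he, hbe⟩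
    exact hbe ((key b hb).trans (key e he).symm)
  -- The lower leg lies inside Γ, but both maximal exponents have vertical slope 0, so it carries no
  -- multiplicity.
  have hdown : ∀ p : ℝ × ℝ, p.1 = x.1.1 → p.2 < x.1.2 → stableMult c x p = 0 := by
    intro p hp1 hp2
    have hp : p = move x.1 (x.1.2 - p.2) (0, -1) := by
      refine Prod.ext ?_ ?_ <;> simp [move, hp1]
    have key : ∀ b, b ∈ dualCell c p ↔ b ∈ dualCell c x.1 := by
      intro b
      rw [hp, mem_dualCell_move_of_forall_le h00 (by decide) (sub_pos.2 hp2)]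
      refine ⟨fun h => h.1, fun h => ⟨h, ?_⟩⟩
      rcases hsub b h with rfl | rfl <;> decide
    have hle : ∀ b ∈ dualCell c p, (b.2 : ℕ) = 0 := by
      intro b hb
      rcases hsub b ((key b).1 hb) with rfl | rfl <;> rfl
    rw [stableMult_lowerLeg hx.le hp1 hp2,
      outgoingSlope_eq (n := 0) ((key _).2 h00) (by decide)
        (fun b hb => by simp [pairing, hle b hb]),
      outgoingSlope_eq (n := 0) ((key _).2 h00) (by decide)
        (fun b hb => by simp [pairing, hle b hb]), add_zero]
  have hv : stableMult c x x.1 = 1 := by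
    have hall : ∀ u n, pairing ((0, 0) : Fin (3 + 1) × Fin (3 + 1)) u ≤ n →
        pairing ((1, 0) : Fin (3 + 1) × Fin (3 + 1)) u ≤ n →
        ∀ b ∈ dualCell c x.1, pairing b u ≤ n := by
      intro u n k1 k2 b hb
      rcases hsub b hb with rfl | rfl <;> assumption
    rw [stableMult_vertexZero hx,
      outgoingSlope_eq (n := 0) h00 (by decide) (hall _ _ (by decide) (by decide)),
      outgoingSlope_eq (n := 0) h00 (by decide) (hall _ _ (by decide) (by decide)),
      outgoingSlope_eq (n := 1) h10 (by decide) (hall _ _ (by decide) (by decide))]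
    norm_num
  set Z := line x ∩ curve c with hZ
  have hvZ : x.1 ∈ Z :=
    ⟨(mem_line hx.le).2 (Or.inl ⟨rfl, le_rfl⟩), mem_curve.2 ⟨_, h00, _, h10, by decide⟩⟩
  -- The boundary of the quadrant U meets Λ only at v₀ + ε(1,1), a point off Γ; hence the component
  -- of v₀ stays inside U.
  have hsubU := connectedComponentIn_subset_of_separated (Z := Z)
    (U := {q | q.1 < x.1.1 + ε} ∩ {q | q.2 < x.1.2 + ε})
    (V := {q | x.1.1 + ε < q.1} ∪ {q | x.1.2 + ε < q.2})
    ((isOpen_lt continuous_fst continuous_const).inter (isOpen_lt continuous_snd continuous_const))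
    ((isOpen_lt continuous_const continuous_fst).union (isOpen_lt continuous_const continuous_snd))
    (by
      rintro q ⟨hq, hqc⟩
      by_contra hcon
      simp only [mem_union, mem_inter_iff, mem_ofPred_eq, not_or, not_lt, not_and] at hcon
      obtain ⟨l1, l2, l3⟩ := hcon
      have : q = move x.1 ε (1, 1) := by
        rcases lt_or_ge q.1 (x.1.1 + ε) with h' | h'
        · have := l1 h'
          refine Prod.ext ?_ ?_ <;> simp only [move, Int.cast_one, mul_one] <;>
          rcases (mem_line hx.le).1 hq with
            ⟨k1, k2⟩ | ⟨k1, k2⟩ | ⟨k1, k2, k3⟩ | ⟨k1, k2⟩ | ⟨k1, k2⟩ <;> linarith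
        · refine Prod.ext ?_ ?_ <;> simp only [move, Int.cast_one, mul_one] <;>
          rcases (mem_line hx.le).1 hq with
            ⟨k1, k2⟩ | ⟨k1, k2⟩ | ⟨k1, k2, k3⟩ | ⟨k1, k2⟩ | ⟨k1, k2⟩ <;> linarith
      exact hoff ε hε0 le_rfl (this ▸ hqc))
    (by
      ext q
      simp only [mem_inter_iff, mem_union, mem_ofPred_eq, mem_empty_iff_false, iff_false]
      rintro ⟨-, ⟨h1, h2⟩, h3 | h3⟩ <;> linarith) hvZ
    ⟨by simp [hε0], by simp [hε0]⟩
  have htotal : ∑ᶠ q ∈ connectedComponentIn Z x.1, stableMult c x q = 1 := by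
    rw [finsum_mem_eq_sum_of_subset (t := {x.1}), Finset.sum_singleton, hv]
    · rintro q ⟨hq, hqs⟩
      rw [Finset.coe_singleton, mem_singleton_iff]
      by_contra hne
      obtain ⟨hqU1, hqU2⟩ := hsubU hq
      obtain ⟨hql, hqc⟩ := connectedComponentIn_subset _ _ hq
      rw [mem_ofPred_eq] at hqU1 hqU2
      rcases (mem_line hx.le).1 hql with
          ⟨k1, k2⟩ | ⟨k1, k2⟩ | ⟨k1, k2, k3⟩ | ⟨k1, k2⟩ | ⟨k1, k2⟩
      · have hlt : q.1 < x.1.1 := lt_of_le_of_ne k2 fun e => hne (Prod.ext e k1)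
        refine hleft (x.1.1 - q.1) (sub_pos.2 hlt) ?_
        convert hqc using 1
        refine Prod.ext ?_ ?_ <;> simp [move, k1]
      · exact hqs (hdown q k1 (lt_of_le_of_ne k2 fun e => hne (Prod.ext k1 e)))
      · have hlt : 0 < q.1 - x.1.1 := lt_of_le_of_ne k2 fun e => hne
          (Prod.ext (by linarith) (by linarith))
        refine hoff (q.1 - x.1.1) hlt (by linarith) ?_
        convert hqc using 1
        refine Prod.ext ?_ ?_ <;> simp only [move, Int.cast_one, mul_one] <;> linarith
      · linarith
      · linarith
    · simpa using mem_connectedComponentIn hvZ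
  have := h.even_of_mem hvZ
  rw [← hZ, htotal] at this
  exact absurd this (by decide)

/-- The exponents of degree at most one. -/
def lowExponents : Finset (Fin (3 + 1) × Fin (3 + 1)) := {(0, 0), (1, 0), (0, 1)}

/-- The dichotomy that governs the motion: `not_dualCell_vertexZero_subset` and its transpose
exclude having exactly one of (1,0), (0,1). -/
theorem dualCell_vertexZero_of_subset (hx : 0 < x.2) (h : IsTritangent c x)
    (hsub : dualCell c x.1 ⊆ lowExponents) :
    dualCell c x.1 = {(0, 0)} ∨ (1, 0) ∈ dualCell c x.1 ∧ (0, 1) ∈ dualCell c x.1 := by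
  have hsub' : ∀ a ∈ dualCell c x.1, a = (0, 0) ∨ a = (1, 0) ∨ a = (0, 1) :=
    fun a ha => by simpa [lowExponents] using hsub ha
  by_cases h10 : (1, 0) ∈ dualCell c x.1
  · by_cases h01 : (0, 1) ∈ dualCell c x.1
    · exact Or.inr ⟨h10, h01⟩
    · refine (not_dualCell_vertexZero_subset hx h h10 fun a ha => ?_).elim
      rcases hsub' a ha with rfl | rfl | rfl
      · exact Or.inl rfl
      · exact Or.inr rfl
      · exact absurd ha h01
  · by_cases h01 : (0, 1) ∈ dualCell c x.1
    · refine (not_dualCell_vertexZero_subset (c := c ∘ Prod.swap) (x := (x.1.swap, x.2)) hx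
        (isTritangent_swap hx.le h) (mem_dualCell_swap.2 h01) fun a ha => ?_).elim
      rcases hsub' _ (mem_dualCell_swap.1 ha) with e | e | e
      · exact Or.inl (Prod.swap_injective e)
      · exact absurd (e ▸ mem_dualCell_swap.1 ha) h10
      · exact Or.inr (Prod.swap_injective e)
    · left
      have key : ∀ a ∈ dualCell c x.1, a = (0, 0) := by
        intro a ha
        rcases hsub' a ha with rfl | rfl | rfl
        · rfl
        · exact absurd ha h10
        · exact absurd ha h01
      obtain ⟨b, hb⟩ := dualCell_nonempty c x.1
      exact Finset.eq_singleton_iff_unique_mem.2 ⟨key b hb ▸ hb, key⟩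

end

section

variable {c : Fin (3 + 1) × Fin (3 + 1) → ℝ} {x : Params} {s : ℝ}

/-! ### Shortening the edge at the lower vertex -/

/-- The curve obtained by moving the lower vertex of a `(1, 1)`-curve with positive edge length
along the edge. -/
def shrink (x : Params) (s : ℝ) : Params := (move x.1 s (1, 1), x.2 - s)

theorem move_one_one_fst (p : ℝ × ℝ) (s : ℝ) : (move p s (1, 1)).1 = p.1 + s := by simp [move]

theorem move_one_one_snd (p : ℝ × ℝ) (s : ℝ) : (move p s (1, 1)).2 = p.2 + s := by simp [move]

theorem move_move (p : ℝ × ℝ) (s t : ℝ) (u : ℤ × ℤ) : move (move p s u) t u = move p (s + t) u := by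
  simp only [move]; refine Prod.ext ?_ ?_ <;> simp <;> ring

/-- The legs at v₀ point left and down and those at v₁ point right and up, so the coordinatewise
order cuts Λ at any point of its edge, as the collapse requires. -/
theorem line_subset_Iic_union_Ici (h0 : 0 ≤ s) (hsx : s ≤ x.2) :
    line x ⊆ Iic (move x.1 s (1, 1)) ∪ Ici (move x.1 s (1, 1)) := by
  intro q hq
  simp only [mem_union, mem_Iic, mem_Ici, Prod.le_def, move_one_one_fst, move_one_one_snd]
  rcases (mem_line (h0.trans hsx)).1 hq with
    ⟨k1, k2⟩ | ⟨k1, k2⟩ | ⟨k1, k2, k3⟩ | ⟨k1, k2⟩ | ⟨k1, k2⟩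
  · exact Or.inl ⟨by linarith, by linarith⟩
  · exact Or.inl ⟨by linarith, by linarith⟩
  · rcases le_total (q.1 - x.1.1) s with h | h
    · exact Or.inl ⟨by linarith, by linarith⟩
    · exact Or.inr ⟨by linarith, by linarith⟩
  · exact Or.inr ⟨by linarith, by linarith⟩
  · exact Or.inr ⟨by linarith, by linarith⟩

theorem dualCell_lineCoeff_shrink (h0 : 0 < s) (hsx : s ≤ x.2) {q : ℝ × ℝ}
    (hq : move x.1 s (1, 1) ≤ q) (hne : q ≠ move x.1 s (1, 1)) :
    dualCell (lineCoeff (shrink x s)) q = dualCell (lineCoeff x) q := by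
  obtain ⟨hq1, hq2⟩ := hq
  rw [move_one_one_fst] at hq1
  rw [move_one_one_snd] at hq2
  have hne' : ¬(q.1 ≤ x.1.1 + s ∧ q.2 ≤ x.1.2 + s) := fun ⟨h1, h2⟩ => hne (Prod.ext
    (by rw [move_one_one_fst]; exact le_antisymm h1 hq1)
    (by rw [move_one_one_snd]; exact le_antisymm h2 hq2))
  obtain ⟨k0, k1, k2, k3⟩ := mem_dualCell_lineCoeff_of_nonneg (h0.le.trans hsx) q
  obtain ⟨l0, l1, l2, l3⟩ := mem_dualCell_lineCoeff_of_nonneg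
    (x := shrink x s) (sub_nonneg.2 hsx) q
  simp only [shrink, move_one_one_fst, move_one_one_snd] at l0 l1 l2 l3
  refine dualCell_lineCoeff_eq ?_ ?_ ?_ ?_
  · rw [k0]
    refine Iff.trans ?_ l0.symm
    exact ⟨fun h => by linarith [h.1], fun h => absurd h hne'⟩
  · rw [k1]
    refine Iff.trans ?_ l1.symm
    exact ⟨fun h => ⟨by linarith, by linarith, by linarith⟩,
      fun h => ⟨by linarith, by linarith, by linarith⟩⟩
  · rw [k2]
    refine Iff.trans ?_ l2.symm
    exact ⟨fun h => ⟨by linarith, by linarith, by linarith⟩,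
      fun h => ⟨by linarith, by linarith, by linarith⟩⟩
  · rw [k3]
    refine Iff.trans ?_ l3.symm
    exact ⟨fun h => ⟨by linarith, by linarith⟩, fun h => ⟨by linarith, by linarith⟩⟩

theorem mem_line_vertexZero (hx : 0 ≤ x.2) : x.1 ∈ line x :=
  (mem_line hx).2 (Or.inl ⟨rfl, le_rfl⟩)

theorem mem_line_move (h0 : 0 ≤ s) (hsx : s ≤ x.2) : move x.1 s (1, 1) ∈ line x :=
  (mem_line (h0.trans hsx)).2 (Or.inr (Or.inr (Or.inl (by
    rw [move_one_one_fst, move_one_one_snd]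
    exact ⟨by ring, by linarith, by linarith⟩))))

theorem line_shrink_inter_Ici (h0 : 0 < s) (hsx : s ≤ x.2) :
    line (shrink x s) ∩ Ici (move x.1 s (1, 1)) = line x ∩ Ici (move x.1 s (1, 1)) := by
  ext q
  refine and_congr_left fun hq => ?_
  by_cases hne : q = move x.1 s (1, 1)
  · subst hne
    exact iff_of_true (mem_line_vertexZero (x := shrink x s) (sub_nonneg.2 hsx))
      (mem_line_move h0.le hsx)
  · simp only [line, curve, mem_ofPred_eq, dualCell_lineCoeff_shrink h0 hsx hq hne]

theorem stableMult_shrink (h0 : 0 < s) (hsx : s ≤ x.2) {q : ℝ × ℝ}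
    (hq : move x.1 s (1, 1) ≤ q) (hne : q ≠ move x.1 s (1, 1)) :
    stableMult c (shrink x s) q = stableMult c x q := by
  rw [stableMult, stableMult, outgoing_eq, outgoing_eq, dualCell_lineCoeff_shrink h0 hsx hq hne]

/-- Shrinking to w replaces the outgoing direction (-1,-1) by (-1,0) and (0,-1). This also holds at
s = ℓ, where w becomes the vertex of a 4-valent curve. -/
theorem stableMult_shrink_self (h0 : 0 < s) (hsx : s ≤ x.2) :
    stableMult c (shrink x s) (move x.1 s (1, 1)) +
        outgoingSlope c (move x.1 s (1, 1)) (-1, -1) =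
      stableMult c x (move x.1 s (1, 1)) + outgoingSlope c (move x.1 s (1, 1)) (-1, 0) +
        outgoingSlope c (move x.1 s (1, 1)) (0, -1) := by
  set w := move x.1 s (1, 1) with hw
  have w1 : w.1 = x.1.1 + s := move_one_one_fst _ _
  have w2 : w.2 = x.1.2 + s := move_one_one_snd _ _
  rcases hsx.lt_or_eq with hlt | rfl
  · rw [stableMult_edge h0 hlt hw, show stableMult c (shrink x s) w = _ from
      stableMult_vertexZero (x := shrink x s) (sub_pos.2 hlt)]
    simp only [shrink, ← hw]
    ring
  · have hD : dualCell (lineCoeff x) w = {(1, 0), (0, 1), (1, 1)} := by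
      obtain ⟨k0, k1, k2, k3⟩ := mem_dualCell_lineCoeff_of_nonneg h0.le w
      refine dualCell_lineCoeff_eq ?_ ?_ ?_ ?_ <;> simp only [k0, k1, k2, k3]
      · exact iff_of_false (by decide) fun h => by linarith [h.1]
      · exact iff_of_true (by decide) ⟨by linarith, by linarith, by linarith⟩
      · exact iff_of_true (by decide) ⟨by linarith, by linarith, by linarith⟩
      · exact iff_of_true (by decide) ⟨by linarith, by linarith⟩
    have hD' : dualCell (lineCoeff (shrink x x.2)) w = {(0, 0), (1, 0), (0, 1), (1, 1)} := by
      rw [show shrink x x.2 = (w, 0) by simp [shrink, ← hw]]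
      obtain ⟨k0, k1, k2, k3⟩ := mem_dualCell_lineCoeff_of_nonneg (x := (w, 0)) le_rfl w
      simp only [sub_self, add_zero, le_refl, and_self, iff_true] at k0 k1 k2 k3
      refine dualCell_lineCoeff_eq ?_ ?_ ?_ ?_
      · exact iff_of_true (by decide) k0
      · exact iff_of_true (by decide) k1
      · exact iff_of_true (by decide) k2
      · exact iff_of_true (by decide) k3
    rw [stableMult, stableMult, outgoing_eq, outgoing_eq, hD, hD',
      lineDirections_values.2.2.2.2.1, lineDirections_values.2.2.2.2.2,
      Finset.sum_insert (by decide), Finset.sum_insert (by decide), Finset.sum_pair (by decide),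
      Finset.sum_insert (by decide), Finset.sum_pair (by decide)]
    ring

/-! ### Lower legs that start at a boundary exponent -/

section Legs

variable {p : ℝ × ℝ} {a : Fin (3 + 1) × Fin (3 + 1)} {u : ℤ × ℤ} {t t' : ℝ}

/-- All exponents that are maximal on such a ray pair equally with u, so the polynomial is linear
along the ray and has no divisor there. -/
theorem slope_add_slope_neg_eq_zero (ha : a ∈ dualCell c p)
    (hu : ∀ b : Fin (3 + 1) × Fin (3 + 1), pairing b u ≤ pairing a u) (ht : 0 < t) :
    outgoingSlope c (move p t u) u + outgoingSlope c (move p t u) (-u) = 0 := by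
  have ha' := (mem_dualCell_move_of_forall_le ha hu ht).2 ⟨ha, rfl⟩
  have hneg : ∀ b : Fin (3 + 1) × Fin (3 + 1), pairing b (-u) = -pairing b u := by
    intro b; simp [pairing]; ring
  rw [outgoingSlope_eq ha' rfl fun b _ => hu b,
    outgoingSlope_eq ha' (hneg a) fun b hb => ?_]
  · ring
  · rw [hneg, ((mem_dualCell_move_of_forall_le ha hu ht).1 hb).2]

/-- The dual cell is constant on the open ray and contained in that of p, so one point of the ray on
Γ puts the whole closed ray on Γ. -/
theorem mem_curve_move_of_mem (ha : a ∈ dualCell c p)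
    (hu : ∀ b : Fin (3 + 1) × Fin (3 + 1), pairing b u ≤ pairing a u) (ht : 0 < t)
    (hc : move p t u ∈ curve c) (ht' : 0 ≤ t') : move p t' u ∈ curve c := by
  obtain ⟨b, hb, e, he, hbe⟩ := mem_curve.1 hc
  rw [mem_dualCell_move_of_forall_le ha hu ht] at hb he
  rcases ht'.eq_or_lt with rfl | h
  · rw [move_zero]
    exact mem_curve.2 ⟨b, hb.1, e, he.1, hbe⟩
  · exact mem_curve.2 ⟨b, (mem_dualCell_move_of_forall_le ha hu h).2 hb, e,
      (mem_dualCell_move_of_forall_le ha hu h).2 he, hbe⟩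

theorem isPreconnected_move_image (p : ℝ × ℝ) (u : ℤ × ℤ) (t : ℝ) :
    IsPreconnected ((fun r => move p r u) '' Icc 0 t) := by
  refine isPreconnected_Icc.image _ (Continuous.continuousOn ?_)
  unfold move
  fun_prop

theorem pairing_neg_one_zero_le (ha : a.1 = 0) (b : Fin (3 + 1) × Fin (3 + 1)) :
    pairing b (-1, 0) ≤ pairing a (-1, 0) := by
  simp [pairing, ha]

theorem pairing_zero_neg_one_le (ha : a.2 = 0) (b : Fin (3 + 1) × Fin (3 + 1)) :
    pairing b (0, -1) ≤ pairing a (0, -1) := by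
  simp [pairing, ha]

end Legs

theorem eq_move_left {p q : ℝ × ℝ} (h : q.2 = p.2) : q = move p (p.1 - q.1) (-1, 0) := by
  refine Prod.ext ?_ ?_ <;> simp [move, h]

theorem eq_move_down {p q : ℝ × ℝ} (h : q.1 = p.1) : q = move p (p.2 - q.2) (0, -1) := by
  refine Prod.ext ?_ ?_ <;> simp [move, h]

/-- If `v₀^∨` contains exponents on the left and lower sides, then the part of the intersection
on the two lower legs is joined to `v₀`, and has multiplicity zero away from `v₀`. -/
theorem lowerLegs (hx : 0 ≤ x.2) {a b : Fin (3 + 1) × Fin (3 + 1)} (ha : a ∈ dualCell c x.1)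
    (ha0 : a.1 = 0) (hb : b ∈ dualCell c x.1) (hb0 : b.2 = 0) {q : ℝ × ℝ}
    (hq : q ∈ line x ∩ curve c) (hqv : q ≤ x.1) :
    x.1 ∈ curve c ∧ (q ≠ x.1 → stableMult c x q = 0) ∧
      ∃ t ⊆ line x ∩ curve c ∩ Iic x.1, x.1 ∈ t ∧ q ∈ t ∧ IsPreconnected t := by
  by_cases hne : q = x.1
  · refine ⟨hne ▸ hq.2, fun h => absurd hne h, {x.1}, ?_, rfl, hne, isPreconnected_singleton⟩
    rintro _ rfl
    exact ⟨hne ▸ hq, mem_Iic.2 le_rfl⟩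
  have hcases : q.2 = x.1.2 ∧ q.1 < x.1.1 ∨ q.1 = x.1.1 ∧ q.2 < x.1.2 := by
    obtain ⟨h1, h2⟩ := hqv
    rcases h1.lt_or_eq with h1 | h1
    · rcases (mem_line hx).1 hq.1 with
        ⟨k1, k2⟩ | ⟨k1, k2⟩ | ⟨k1, k2, k3⟩ | ⟨k1, k2⟩ | ⟨k1, k2⟩
      · exact Or.inl ⟨k1, h1⟩
      all_goals linarith
    · exact Or.inr ⟨h1, lt_of_le_of_ne h2 fun h => hne (Prod.ext h1 h)⟩
  rcases hcases with ⟨h2, h1⟩ | ⟨h1, h2⟩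
  · have hu := pairing_neg_one_zero_le ha0
    have hq' := eq_move_left h2
    have ht := sub_pos.2 h1
    set t := x.1.1 - q.1
    have hmem : ∀ t', 0 ≤ t' → move x.1 t' (-1, 0) ∈ curve c :=
      fun t' => mem_curve_move_of_mem ha hu ht (hq' ▸ hq.2)
    refine ⟨by simpa using hmem 0 le_rfl, fun _ => ?_, (fun r => move x.1 r (-1, 0)) '' Icc 0 t, ?_,
      ⟨0, ⟨le_rfl, ht.le⟩, by simp⟩, ⟨t, ⟨ht.le, le_rfl⟩, hq'.symm⟩,
      isPreconnected_move_image x.1 (-1, 0) t⟩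
    · rw [stableMult_leftLeg hx h1 h2, hq', add_comm]
      exact slope_add_slope_neg_eq_zero ha hu ht
    · rintro _ ⟨r, hr, rfl⟩
      refine ⟨⟨(mem_line hx).2 (Or.inl ?_), hmem r hr.1⟩, ?_⟩
      · simp [move, hr.1]
      · simp [Prod.le_def, move, hr.1]
  · have hu := pairing_zero_neg_one_le hb0
    have hq' := eq_move_down h1
    have ht := sub_pos.2 h2
    set t := x.1.2 - q.2
    have hmem : ∀ t', 0 ≤ t' → move x.1 t' (0, -1) ∈ curve c :=
      fun t' => mem_curve_move_of_mem hb hu ht (hq' ▸ hq.2)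
    refine ⟨by simpa using hmem 0 le_rfl, fun _ => ?_, (fun r => move x.1 r (0, -1)) '' Icc 0 t, ?_,
      ⟨0, ⟨le_rfl, ht.le⟩, by simp⟩, ⟨t, ⟨ht.le, le_rfl⟩, hq'.symm⟩,
      isPreconnected_move_image x.1 (0, -1) t⟩
    · rw [stableMult_lowerLeg hx h1 h2, hq', add_comm]
      exact slope_add_slope_neg_eq_zero hb hu ht
    · rintro _ ⟨r, hr, rfl⟩
      refine ⟨⟨(mem_line hx).2 (Or.inr (Or.inl ?_)), hmem r hr.1⟩, ?_⟩
      · simp [move, hr.1]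
      · simp [Prod.le_def, move, hr.1]

/-- Moving the lower vertex up to `w` preserves tritangency if the part of the intersection below
`w` is connected and has the same multiplicity before and after. -/
theorem isTritangent_shrink_of (h0 : 0 < s) (hsx : s ≤ x.2) (h : IsTritangent c x)
    {a b : Fin (3 + 1) × Fin (3 + 1)} (ha : a ∈ dualCell c (move x.1 s (1, 1))) (ha0 : a.1 = 0)
    (hb : b ∈ dualCell c (move x.1 s (1, 1))) (hb0 : b.2 = 0)
    (hS : IsPreconnected (line x ∩ curve c ∩ Iic (move x.1 s (1, 1))))
    (hw : (line x ∩ curve c ∩ Iic (move x.1 s (1, 1))).Nonempty → move x.1 s (1, 1) ∈ curve c)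
    {A : Finset (ℝ × ℝ)} (hA : ↑A ⊆ line x ∩ curve c ∩ Iic (move x.1 s (1, 1)))
    (hA' : ∀ q ∈ line x ∩ curve c, q ≤ move x.1 s (1, 1) → q ∉ A → stableMult c x q = 0)
    (hsum : move x.1 s (1, 1) ∈ curve c → ∑ q ∈ A, stableMult c x q =
      stableMult c (shrink x s) (move x.1 s (1, 1))) :
    IsTritangent c (shrink x s) := by
  set w := move x.1 s (1, 1) with hwdef
  have hx' : 0 ≤ (shrink x s).2 := sub_nonneg.2 hsx
  have hwx : w ∈ line x := mem_line_move h0.le hsx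
  have hsupp : line x ∩ curve c ∩ Iic w ∩ Function.support (stableMult c x) ⊆ ↑A := by
    rintro q ⟨⟨hq, hqw⟩, hqs⟩
    by_contra hqA
    exact hqs (hA' q hq hqw hqA)
  -- Both curves collapse to the same set `Λ ∩ Γ ∩ Ici w` with the multiplicities of the shrunk
  -- curve: `e1` does this for the original curve, `e2` for the shrunk one.
  have e1 := hasTritangentType_collapse (Z := line x ∩ curve c) (w := w) (m := stableMult c x)
    (m' := stableMult c (shrink x s))
    (inter_subset_left.trans (line_subset_Iic_union_Ici h0.le hsx)) hS
    (fun hne => ⟨hwx, hw hne⟩) (fun q hq hne => stableMult_shrink h0 hsx hq.2 hne)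
    (A.finite_toSet.subset hsupp)
    (fun hwZ => by rw [finsum_mem_eq_sum_of_subset _ hsupp hA]; exact hsum hwZ.2)
  have hlegs : ∀ q ∈ line (shrink x s) ∩ curve c ∩ Iic w, _ := fun q hq =>
    lowerLegs (x := shrink x s) hx' ha ha0 hb hb0 hq.1 hq.2
  have hsub : line (shrink x s) ⊆ Iic w ∪ Ici w := by
    have := line_subset_Iic_union_Ici (x := shrink x s) le_rfl hx'
    rwa [move_zero] at this
  have hsupp' : line (shrink x s) ∩ curve c ∩ Iic w ∩
      Function.support (stableMult c (shrink x s)) ⊆ ↑({w} : Finset (ℝ × ℝ)) := by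
    rintro q ⟨hq, hqs⟩
    by_contra hqA
    exact hqs ((hlegs q hq).2.1 fun e => hqA (Finset.mem_coe.2 (Finset.mem_singleton.2 e)))
  have hwx' : w ∈ line (shrink x s) := mem_line_vertexZero hx'
  have e2 := hasTritangentType_collapse (Z := line (shrink x s) ∩ curve c) (w := w)
    (m := stableMult c (shrink x s)) (m' := stableMult c (shrink x s))
    (inter_subset_left.trans hsub)
    (isPreconnected_of_forall w fun q hq => (hlegs q hq).2.2)
    (fun ⟨q, hq⟩ => ⟨hwx', (hlegs q hq).1⟩) (fun q _ _ => rfl)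
    ((Finset.finite_toSet _).subset hsupp')
    (fun hwZ => by
      rw [finsum_mem_eq_sum_of_subset _ hsupp'
        (by rw [Finset.coe_singleton, singleton_subset_iff]; exact ⟨hwZ, mem_Iic.2 le_rfl⟩), Finset.sum_singleton])
  rw [isTritangent_iff] at h ⊢
  rw [← e1] at h
  rw [← e2]
  have : line (shrink x s) ∩ curve c ∩ Ici w = line x ∩ curve c ∩ Ici w := by
    rw [inter_right_comm, line_shrink_inter_Ici h0 hsx, inter_right_comm]
  rwa [this]

end

/-! ### Tritangency while the lower vertex moves up to the stopping time -/

section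

variable {c : Fin (3 + 1) × Fin (3 + 1) → ℝ} {x : Params} {s : ℝ}

@[simp] theorem shrink_zero (x : Params) : shrink x 0 = x := by simp [shrink]

theorem shrink_shrink (x : Params) (s t : ℝ) : shrink (shrink x s) t = shrink x (s + t) := by
  simp only [shrink, move_move]
  refine Prod.ext rfl ?_
  simp only; ring

theorem eq_move_diag {p q : ℝ × ℝ} (h : q.1 - p.1 = q.2 - p.2) :
    q = move p (q.1 - p.1) (1, 1) := by
  refine Prod.ext ?_ ?_
  · rw [move_one_one_fst]; ring
  · rw [move_one_one_snd]; linarith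

/-- The part of a `(1, 1)`-curve below a point of its edge. -/
theorem le_or_eq_move_of_mem_line (hx : 0 ≤ x.2) {q : ℝ × ℝ} (hq : q ∈ line x)
    (hqw : q ≤ move x.1 s (1, 1)) (hsx : s ≤ x.2) :
    q ≤ x.1 ∨ ∃ t, 0 < t ∧ t ≤ s ∧ q = move x.1 t (1, 1) := by
  obtain ⟨h1, h2⟩ := hqw
  rw [move_one_one_fst] at h1
  rw [move_one_one_snd] at h2
  have hdiag : q.1 - x.1.1 = q.2 - x.1.2 → 0 ≤ q.1 - x.1.1 →
      q ≤ x.1 ∨ ∃ t, 0 < t ∧ t ≤ s ∧ q = move x.1 t (1, 1) := by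
    intro k1 k2
    rcases k2.eq_or_lt with k | k
    · exact Or.inl ⟨by linarith, by linarith⟩
    · exact Or.inr ⟨_, k, by linarith, eq_move_diag k1⟩
  rcases (mem_line hx).1 hq with
    ⟨k1, k2⟩ | ⟨k1, k2⟩ | ⟨k1, k2, k3⟩ | ⟨k1, k2⟩ | ⟨k1, k2⟩
  · exact Or.inl ⟨k2, k1.le⟩
  · exact Or.inl ⟨k1.le, k2⟩
  · exact hdiag k1 k2
  · exact hdiag (by linarith) (by linarith)
  · exact hdiag (by linarith) (by linarith)

/-- The lower vertex may be moved up inside the closure of the chamber of `(0, 0)`. -/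
theorem isTritangent_shrink_of_chamber (h0 : 0 < s) (hsx : s ≤ x.2) (h : IsTritangent c x)
    (hv : dualCell c x.1 = {(0, 0)}) (hw : (0, 0) ∈ dualCell c (move x.1 s (1, 1))) :
    IsTritangent c (shrink x s) := by
  classical
  have hx := h0.le.trans hsx
  have hv0 : (0, 0) ∈ dualCell c x.1 := by simp [hv]
  have hvc := notMem_curve_of_dualCell_eq_singleton hv
  -- A point of Γ on a lower leg would force v₀ onto Γ, and the open segment from v₀ to w lies in
  -- the chamber of (0,0).
  have key : ∀ q ∈ line x ∩ curve c, q ≤ move x.1 s (1, 1) → q = move x.1 s (1, 1) := by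
    intro q hq hqw
    rcases le_or_eq_move_of_mem_line hx hq.1 hqw hsx with hle | ⟨t, ht0, hts, rfl⟩
    · exact absurd (lowerLegs hx hv0 rfl hv0 rfl hq hle).1 hvc
    · rcases hts.lt_or_eq with hlt | rfl
      · obtain ⟨a, ha, b, hb, hab⟩ := mem_curve.1 hq.2
        rw [mem_dualCell_move_of_mem hv0 hw ht0 hlt, hv, Finset.mem_singleton] at ha hb
        exact absurd (ha.1.trans hb.1.symm) hab
      · rfl
  have hmult : stableMult c x (move x.1 s (1, 1)) =
      stableMult c (shrink x s) (move x.1 s (1, 1)) := by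
    have := stableMult_shrink_self (c := c) h0 hsx
    rw [outgoingSlope_eq (n := 0) hw (by decide) (fun b _ => by simp [pairing]),
      outgoingSlope_eq (n := 0) hw (by decide) (fun b _ => by simp [pairing]),
      outgoingSlope_eq (n := 0) hw (by decide) (fun b _ => by simp [pairing])] at this
    simpa using this.symm
  have hsub : (line x ∩ curve c ∩ Iic (move x.1 s (1, 1))).Subsingleton :=
    fun q hq q' hq' => (key q hq.1 hq.2).trans (key q' hq'.1 hq'.2).symm
  by_cases hwc : move x.1 s (1, 1) ∈ curve c
  · refine isTritangent_shrink_of h0 hsx h hw rfl hw rfl hsub.isPreconnected (fun _ => hwc)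
      (A := {move x.1 s (1, 1)}) ?_ ?_ ?_
    · rw [Finset.coe_singleton, singleton_subset_iff]
      exact ⟨⟨mem_line_move h0.le hsx, hwc⟩, mem_Iic.2 le_rfl⟩
    · intro q hq hqw hne
      exact absurd (Finset.mem_singleton.2 (key q hq hqw)) hne
    · intro _
      rw [Finset.sum_singleton, hmult]
  · refine isTritangent_shrink_of h0 hsx h hw rfl hw rfl hsub.isPreconnected ?_
      (A := ∅) (by simp) ?_ (fun h => absurd h hwc)
    · rintro ⟨q, hq, hqw⟩
      exact key q hq hqw ▸ hq.2
    · intro q hq hqw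
      exact absurd (key q hq hqw ▸ hq.2) hwc

/-- The lower vertex may be moved up along the edge dual to the segment between `(1, 0)` and
`(0, 1)`. -/
theorem isTritangent_shrink_of_edge (h0 : 0 < s) (hsx : s ≤ x.2) (h : IsTritangent c x)
    (hsub : dualCell c x.1 ⊆ lowExponents)
    (hv10 : (1, 0) ∈ dualCell c x.1) (hv01 : (0, 1) ∈ dualCell c x.1)
    (hw10 : (1, 0) ∈ dualCell c (move x.1 s (1, 1)))
    (hw01 : (0, 1) ∈ dualCell c (move x.1 s (1, 1))) :
    IsTritangent c (shrink x s) := by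
  classical
  have hx := h0.trans_le hsx
  set w := move x.1 s (1, 1) with hwdef
  -- In direction (1,1) the exponent (1,0) strictly gains on (0,0).
  have hw00 : (0, 0) ∉ dualCell c w := by
    intro hcon
    have h1 := mem_dualCell.1 hcon (1, 0)
    have h2 := mem_dualCell.1 hv10 (0, 0)
    rw [hwdef, monomial_move, monomial_move] at h1
    simp [pairing] at h1
    linarith
  have hdown : ∀ b : Fin (3 + 1) × Fin (3 + 1), b ≠ (0, 0) → pairing b (-1, -1) ≤ -1 := by
    decide
  have hup : ∀ b ∈ dualCell c x.1, pairing b (1, 1) ≤ 1 := by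
    have : ∀ b ∈ lowExponents, pairing b (1, 1) ≤ 1 := by decide
    exact fun b hb => this b (hsub hb)
  have hcurve : ∀ t, 0 ≤ t → t ≤ s → move x.1 t (1, 1) ∈ curve c := by
    intro t ht hts
    refine mem_curve.2 ⟨(1, 0), ?_, (0, 1), ?_, by decide⟩
    · rcases ht.eq_or_lt with rfl | ht
      · rwa [move_zero]
      · rcases hts.lt_or_eq with hts | rfl
        · exact (mem_dualCell_move_of_mem hv10 hw10 ht hts).2 ⟨hv10, hw10⟩
        · exact hw10
    · rcases ht.eq_or_lt with rfl | ht
      · rwa [move_zero]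
      · rcases hts.lt_or_eq with hts | rfl
        · exact (mem_dualCell_move_of_mem hv01 hw01 ht hts).2 ⟨hv01, hw01⟩
        · exact hw01
  have hle : ∀ t, t ≤ s → move x.1 t (1, 1) ≤ w := by
    intro t ht
    simp only [Prod.le_def, hwdef, move_one_one_fst, move_one_one_snd]
    exact ⟨by linarith, by linarith⟩
  have hvle : x.1 ≤ w := by simpa using hle 0 h0.le
  have hvZ : x.1 ∈ line x ∩ curve c :=
    ⟨mem_line_vertexZero hx.le, by simpa using hcurve 0 le_rfl h0.le⟩
  have hwZ : w ∈ line x ∩ curve c := ⟨mem_line_move h0.le hsx, hcurve s h0.le le_rfl⟩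
  have hvw : x.1 ≠ w := by
    intro e
    have := congrArg Prod.fst e
    rw [hwdef, move_one_one_fst] at this
    linarith
  refine isTritangent_shrink_of h0 hsx h hw01 rfl hw10 rfl ?_ (fun _ => hwZ.2)
    (A := {x.1, w}) ?_ ?_ ?_
  · refine isPreconnected_of_forall x.1 fun q hq => ?_
    rcases le_or_eq_move_of_mem_line hx.le hq.1.1 hq.2 hsx with hqv | ⟨t, ht0, hts, rfl⟩
    · obtain ⟨T, hT, h1⟩ := (lowerLegs hx.le hv01 rfl hv10 rfl hq.1 hqv).2.2
      exact ⟨T, hT.trans (inter_subset_inter_right _ (Iic_subset_Iic.2 hvle)), h1⟩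
    · refine ⟨(fun r => move x.1 r (1, 1)) '' Icc 0 t, ?_, ⟨0, ⟨le_rfl, ht0.le⟩, by simp⟩,
        ⟨t, ⟨ht0.le, le_rfl⟩, rfl⟩, isPreconnected_move_image _ _ _⟩
      rintro _ ⟨r, hr, rfl⟩
      exact ⟨⟨mem_line_move hr.1 (hr.2.trans (hts.trans hsx)), hcurve r hr.1 (hr.2.trans hts)⟩,
        hle r (hr.2.trans hts)⟩
  · rw [Finset.coe_pair, insert_subset_iff, singleton_subset_iff]
    exact ⟨⟨hvZ, hvle⟩, hwZ, mem_Iic.2 le_rfl⟩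
  · intro q hq hqw hqA
    rw [Finset.mem_insert, Finset.mem_singleton, not_or] at hqA
    rcases le_or_eq_move_of_mem_line hx.le hq.1 hqw hsx with hqv | ⟨t, ht0, hts, rfl⟩
    · exact (lowerLegs hx.le hv01 rfl hv10 rfl hq hqv).2.1 hqA.1
    · have hlt : t < s := lt_of_le_of_ne hts fun e => hqA.2 (by rw [e])
      have hmem : ∀ b, b ∈ dualCell c (move x.1 t (1, 1)) ↔ b ∈ dualCell c x.1 ∧ b ∈ dualCell c w :=
        fun b => mem_dualCell_move_of_mem hv10 hw10 ht0 hlt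
      have h10 := (hmem _).2 ⟨hv10, hw10⟩
      rw [stableMult_edge ht0 (hlt.trans_le hsx) rfl,
        outgoingSlope_eq (n := 1) h10 (by decide) (fun b hb => hup b ((hmem b).1 hb).1),
        outgoingSlope_eq (n := -1) h10 (by decide)
          (fun b hb => hdown b fun e => hw00 (e ▸ ((hmem b).1 hb).2))]
      rfl
  · intro _
    -- The multiplicity 1 of v₀ is exactly what w gains: the slope -1 in direction (-1,-1) is traded
    -- for two slopes 0.
    have hmult := stableMult_shrink_self (c := c) h0 hsx
    rw [← hwdef, outgoingSlope_eq (n := -1) hw10 (by decide)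
        (fun b hb => hdown b fun e => hw00 (e ▸ hb)),
      outgoingSlope_eq (n := 0) hw01 (by decide) (fun b _ => by simp [pairing]),
      outgoingSlope_eq (n := 0) hw10 (by decide) (fun b _ => by simp [pairing])] at hmult
    rw [Finset.sum_pair hvw, stableMult_vertexZero hx,
      outgoingSlope_eq (n := 0) hv01 (by decide) (fun b _ => by simp [pairing]),
      outgoingSlope_eq (n := 0) hv10 (by decide) (fun b _ => by simp [pairing]),
      outgoingSlope_eq (n := 1) hv10 (by decide) hup]
    linarith

/-! ### The stopping time -/

theorem lowExponents_nonempty : lowExponents.Nonempty := ⟨(0, 0), by decide⟩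

theorem lowExponents_compl_nonempty : lowExponentsᶜ.Nonempty := ⟨(3, 3), by decide⟩

/-- The time at which the exponents of degree at least two catch up with those of degree at most
one, when `v` moves with velocity `(1, 1)`. -/
def stopTime (c : Fin (3 + 1) × Fin (3 + 1) → ℝ) (v : ℝ × ℝ) : ℝ :=
  lowExponentsᶜ.inf' lowExponents_compl_nonempty fun b =>
    lowExponents.sup' lowExponents_nonempty fun a =>
      (monomial c a v - monomial c b v) / (pairing b (1, 1) - pairing a (1, 1) : ℤ)

theorem continuous_stopTime (c : Fin (3 + 1) × Fin (3 + 1) → ℝ) : Continuous (stopTime c) := by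
  unfold stopTime
  refine Continuous.finset_inf'_apply _ fun b _ => Continuous.finset_sup'_apply _ fun a _ => ?_
  unfold monomial
  fun_prop

theorem pairing_lt_of_notMem_lowExponents : ∀ a ∈ lowExponents, ∀ b ∈ lowExponentsᶜ,
    0 < pairing b (1, 1) - pairing a (1, 1) := by
  decide

variable {v : ℝ × ℝ} {t : ℝ}

/-- Each quotient is the time at which b catches up with a, the difference of their pairings being
the relative speed. To become maximal, b must catch up with every low a, hence the supremum; the
first b to do so gives the infimum. -/
theorem lt_stopTime : t < stopTime c v ↔ dualCell c (move v t (1, 1)) ⊆ lowExponents := by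
  have key : t < stopTime c v ↔ ∀ b ∈ lowExponentsᶜ, ∃ a ∈ lowExponents,
      monomial c b (move v t (1, 1)) < monomial c a (move v t (1, 1)) := by
    rw [stopTime, Finset.lt_inf'_iff]
    refine forall₂_congr fun b hb => ?_
    rw [Finset.lt_sup'_iff]
    refine exists_congr fun a => and_congr_right fun ha => ?_
    have : (0 : ℝ) < (pairing b (1, 1) - pairing a (1, 1) : ℤ) := by
      exact_mod_cast pairing_lt_of_notMem_lowExponents a ha b hb
    rw [lt_div_iff₀ this, monomial_move, monomial_move]
    push_cast
    constructor <;> intro h <;> linarith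
  rw [key]
  constructor
  · intro h b hb
    by_contra hbl
    obtain ⟨a, -, hab⟩ := h b (Finset.mem_compl.2 hbl)
    exact absurd (mem_dualCell.1 hb a) hab.not_ge
  · intro h b hb
    obtain ⟨a, ha⟩ := dualCell_nonempty c (move v t (1, 1))
    exact ⟨a, h ha, monomial_lt_of_notMem_dualCell ha fun hb' => Finset.mem_compl.1 hb (h hb')⟩

/-- At the stopping time itself a low exponent is still tied for the maximum; this lets the motion
include its end point. -/
theorem exists_mem_of_le_stopTime (h : t ≤ stopTime c v) :
    ∃ a ∈ dualCell c (move v t (1, 1)), a ∈ lowExponents := by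
  obtain ⟨b, hb⟩ := dualCell_nonempty c (move v t (1, 1))
  by_cases hbl : b ∈ lowExponents
  · exact ⟨b, hb, hbl⟩
  have h1 := (Finset.le_inf'_iff _ _).1 h b (Finset.mem_compl.2 hbl)
  obtain ⟨a, ha, h2⟩ := (Finset.le_sup'_iff _).1 h1
  refine ⟨a, ?_, ha⟩
  have : (0 : ℝ) < (pairing b (1, 1) - pairing a (1, 1) : ℤ) := by
    exact_mod_cast pairing_lt_of_notMem_lowExponents a ha b (Finset.mem_compl.2 hbl)
  rw [le_div_iff₀ this] at h2
  push_cast at h2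
  refine (mem_dualCell_iff_eq hb).2 (le_antisymm (mem_dualCell.1 hb a) ?_)
  rw [monomial_move, monomial_move]
  linarith

theorem stopTime_pos : 0 < stopTime c v ↔ dualCell c v ⊆ lowExponents := by
  rw [lt_stopTime, move_zero]

theorem stopTime_move : stopTime c (move v s (1, 1)) = stopTime c v - s := by
  refine eq_of_forall_lt_iff fun t => ?_
  rw [lt_stopTime, move_move, ← lt_stopTime, lt_sub_iff_add_lt, add_comm]

/-- The first time at which a point of the chamber of `(0, 0)` leaves it in direction `(1, 1)`. -/
theorem exists_exit (hv : dualCell c v = {(0, 0)})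
    (hs : (0, 0) ∉ dualCell c (move v s (1, 1))) :
    ∃ t, 0 < t ∧ t < s ∧ (0, 0) ∈ dualCell c (move v t (1, 1)) ∧
      dualCell c (move v t (1, 1)) ≠ {(0, 0)} := by
  have hpos : ∀ b ∈ ({(0, 0)}ᶜ : Finset (Fin (3 + 1) × Fin (3 + 1))), 0 < pairing b (1, 1) := by
    decide
  have hpos' : ∀ b : Fin (3 + 1) × Fin (3 + 1), b ≠ (0, 0) → (0 : ℝ) < pairing b (1, 1) := by
    intro b hb
    exact_mod_cast hpos b (by simpa using hb)
  have h00 : ((pairing ((0, 0) : Fin (3 + 1) × Fin (3 + 1)) (1, 1) : ℤ) : ℝ) = 0 := by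
    simp [pairing]
  have hv0 : (0, 0) ∈ dualCell c v := by simp [hv]
  -- The exponent b is the first one to tie with (0,0), and t is the time of the tie.
  obtain ⟨b, hb, hmin⟩ := Finset.exists_min_image
    ({(0, 0)}ᶜ : Finset (Fin (3 + 1) × Fin (3 + 1)))
    (fun b => (monomial c (0, 0) v - monomial c b v) / (pairing b (1, 1) : ℝ))
    ⟨(3, 3), by decide⟩
  have hb' : b ≠ (0, 0) := by simpa using hb
  set t := (monomial c (0, 0) v - monomial c b v) / (pairing b (1, 1) : ℝ) with ht
  have htb : t * pairing b (1, 1) = monomial c (0, 0) v - monomial c b v :=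
    div_mul_cancel₀ _ (hpos' b hb').ne'
  have hmem : (0, 0) ∈ dualCell c (move v t (1, 1)) := by
    refine mem_dualCell.2 fun e => ?_
    by_cases he : e = (0, 0)
    · rw [he]
    have := (le_div_iff₀ (hpos' e he)).1 (hmin e (by simpa using he))
    rw [monomial_move, monomial_move, h00]
    linarith
  have hmemb : b ∈ dualCell c (move v t (1, 1)) := by
    rw [mem_dualCell_iff_eq hmem, monomial_move, monomial_move, h00, htb]
    ring
  refine ⟨t, div_pos (sub_pos.2 (monomial_lt_of_notMem_dualCell hv0 ?_)) (hpos' b hb'), ?_, hmem,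
    fun h => hb' (by rwa [h, Finset.mem_singleton] at hmemb)⟩
  · rwa [hv, Finset.mem_singleton]
  · by_contra! hst
    apply hs
    refine mem_dualCell.2 fun e => ?_
    by_cases he : e = (0, 0)
    · rw [he]
    have h1 := (le_div_iff₀ (hpos' e he)).1 (hst.trans (hmin e (by simpa using he)))
    rw [monomial_move, monomial_move, h00]
    linarith

/-- The exponents (1,0) and (0,1) stay tied in direction (1,1) and pull ahead of (0,0), so they
remain maximal as long as some low exponent is. -/
theorem isTritangent_shrink_of_edge_of_le_stopTime (h0 : 0 ≤ s) (hsx : s ≤ x.2) (h : IsTritangent c x)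
    (hsub : dualCell c x.1 ⊆ lowExponents)
    (hv10 : (1, 0) ∈ dualCell c x.1) (hv01 : (0, 1) ∈ dualCell c x.1)
    (hs : s ≤ stopTime c x.1) : IsTritangent c (shrink x s) := by
  rcases h0.eq_or_lt with rfl | h0
  · simpa using h
  obtain ⟨a, ha, hal⟩ := exists_mem_of_le_stopTime hs
  have heq : monomial c (1, 0) (move x.1 s (1, 1)) = monomial c (0, 1) (move x.1 s (1, 1)) := by
    rw [monomial_move, monomial_move, monomial_eq_of_mem_dualCell hv10 hv01]
    simp [pairing]
  have h10 : (1, 0) ∈ dualCell c (move x.1 s (1, 1)) := by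
    have : a = (0, 0) ∨ a = (1, 0) ∨ a = (0, 1) := by simpa [lowExponents] using hal
    rcases this with rfl | rfl | rfl
    · exfalso
      have h1 := mem_dualCell.1 ha (1, 0)
      have h2 := mem_dualCell.1 hv10 (0, 0)
      rw [monomial_move, monomial_move] at h1
      simp [pairing] at h1
      linarith
    · exact ha
    · exact (mem_dualCell_iff_eq ha).2 heq
  exact isTritangent_shrink_of_edge h0 hsx h hsub hv10 hv01 h10
    ((mem_dualCell_iff_eq h10).2 heq.symm)

/-- The lower vertex of a tritangent curve may be moved up until the stopping time. -/
theorem isTritangent_shrink (h0 : 0 ≤ s) (hsx : s ≤ x.2) (h : IsTritangent c x)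
    (hτ : 0 < stopTime c x.1) (hs : s ≤ stopTime c x.1) : IsTritangent c (shrink x s) := by
  rcases h0.eq_or_lt with rfl | h0
  · simpa using h
  have hsub := stopTime_pos.1 hτ
  rcases dualCell_vertexZero_of_subset (h0.trans_le hsx) h hsub with hv | ⟨h10, h01⟩
  · by_cases hw : (0, 0) ∈ dualCell c (move x.1 s (1, 1))
    · exact isTritangent_shrink_of_chamber h0 hsx h hv hw
    -- The curve at the exit time t is tritangent again, so the dichotomy makes (1,0) and (0,1)
    -- maximal there; the rest of the motion follows that edge of Γ.
    obtain ⟨t, ht0, hts, ht, hne⟩ := exists_exit hv hw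
    have h' := isTritangent_shrink_of_chamber ht0 (hts.le.trans hsx) h hv ht
    have hsub' : dualCell c (shrink x t).1 ⊆ lowExponents :=
      lt_stopTime.1 (hts.trans_le hs)
    have hx' : 0 < (shrink x t).2 := sub_pos.2 (hts.trans_le hsx)
    obtain ⟨h10, h01⟩ := (dualCell_vertexZero_of_subset hx' h' hsub').resolve_left hne
    have := isTritangent_shrink_of_edge_of_le_stopTime (s := s - t) (sub_nonneg.2 hts.le)
      (sub_le_sub_right hsx t) h' hsub' h10 h01 (by
        simp only [shrink, stopTime_move]
        linarith)
    rwa [shrink_shrink, add_sub_cancel] at this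
  · exact isTritangent_shrink_of_edge_of_le_stopTime h0.le hsx h hsub h10 h01 hs

end

section

variable {c c' : Fin (3 + 1) × Fin (3 + 1) → ℝ} {x : Params} {t : ℝ}

/-! ### Retractions of the space of tritangent curves -/

/-- `H` deforms the space of tritangent curves into the complement of `B`, at which it is
stationary. -/
structure IsRetraction (c : Fin (3 + 1) × Fin (3 + 1) → ℝ) (B : Params → Prop)
    (H : ℝ → Params → Params) : Prop where
  continuous : Continuous fun p : ℝ × Params => H p.1 p.2
  zero : ∀ x, H 0 x = x
  isTritangent : ∀ t ∈ Icc (0 : ℝ) 1, ∀ x, IsTritangent c x → IsTritangent c (H t x)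
  eq_self : ∀ t x, ¬ B x → H t x = x
  one : ∀ x, ¬ B (H 1 x)

theorem IsRetraction.conj {B : Params → Prop} {H : ℝ → Params → Params}
    (hH : IsRetraction c' B H) {Θ : Params → Params} (hΘ : Continuous Θ)
    (hinv : ∀ x, Θ (Θ x) = x) (htrit : ∀ x, IsTritangent c' (Θ x) ↔ IsTritangent c x) :
    IsRetraction c (fun x => B (Θ x)) fun t x => Θ (H t (Θ x)) where
  continuous := hΘ.comp (hH.continuous.comp (continuous_fst.prodMk (hΘ.comp continuous_snd)))
  zero x := by rw [hH.zero, hinv]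
  isTritangent t ht x hx := by
    rw [← htrit, hinv]
    exact hH.isTritangent t ht _ ((htrit x).2 hx)
  eq_self t x hx := by rw [hH.eq_self t _ hx, hinv]
  one x := by rw [hinv]; exact hH.one _

/-- The condition `h` says that the second flow does not undo the result of the first. -/
theorem IsRetraction.comp {B B' : Params → Prop} {H H' : ℝ → Params → Params}
    (hH : IsRetraction c B H) (hH' : IsRetraction c B' H') (h : ∀ x, ¬ B x → ¬ B (H' 1 x)) :
    IsRetraction c (fun x => B x ∨ B' x) fun t x => H' t (H t x) where
  continuous := hH'.continuous.comp (continuous_fst.prodMk hH.continuous)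
  zero x := by rw [hH.zero, hH'.zero]
  isTritangent t ht x hx := hH'.isTritangent t ht _ (hH.isTritangent t ht x hx)
  eq_self t x hx := by
    rw [not_or] at hx
    rw [hH.eq_self t x hx.1, hH'.eq_self t x hx.2]
  one x := not_or.2 ⟨h _ (hH.one x), hH'.one _⟩

/-- The edge has positive length, and the lower vertex can be moved up along it. -/
def CanShrink (c : Fin (3 + 1) × Fin (3 + 1) → ℝ) (x : Params) : Prop :=
  0 < x.2 ∧ 0 < stopTime c x.1

/-- Move the lower vertex up along the edge until the stopping time. -/
def shrinkFlow (c : Fin (3 + 1) × Fin (3 + 1) → ℝ) (t : ℝ) (x : Params) : Params :=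
  -- The truncations at 0 make the length continuous everywhere and zero exactly when `CanShrink`
  -- fails.
  shrink x (t * min (max (stopTime c x.1) 0) (max x.2 0))

theorem shrinkFlow_eq_self (h : ¬ CanShrink c x) : shrinkFlow c t x = x := by
  have : min (max (stopTime c x.1) 0) (max x.2 0) = 0 := by
    refine le_antisymm ?_ (le_min (le_max_right _ _) (le_max_right _ _))
    by_cases h1 : 0 < x.2
    · have h2 : stopTime c x.1 ≤ 0 := not_lt.1 fun h2 => h ⟨h1, h2⟩
      exact (min_le_left _ _).trans (max_le h2 le_rfl)
    · exact (min_le_right _ _).trans (max_le (not_lt.1 h1) le_rfl)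
  rw [shrinkFlow, this, mul_zero, shrink_zero]

theorem exists_shrinkFlow_eq (ht : t ∈ Icc (0 : ℝ) 1) (h : CanShrink c x) :
    ∃ s, 0 ≤ s ∧ s ≤ x.2 ∧ s ≤ stopTime c x.1 ∧ shrinkFlow c t x = shrink x s := by
  have h1 : 0 ≤ min (stopTime c x.1) x.2 := le_min h.2.le h.1.le
  refine ⟨t * min (stopTime c x.1) x.2, mul_nonneg ht.1 h1, ?_, ?_, ?_⟩
  · exact (mul_le_of_le_one_left h1 ht.2).trans (min_le_right _ _)
  · exact (mul_le_of_le_one_left h1 ht.2).trans (min_le_left _ _)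
  · rw [shrinkFlow, max_eq_left h.1.le, max_eq_left h.2.le]

theorem isRetraction_shrinkFlow (c : Fin (3 + 1) × Fin (3 + 1) → ℝ) :
    IsRetraction c (CanShrink c) (shrinkFlow c) where
  continuous := by
    have h1 : Continuous fun p : ℝ × Params => stopTime c p.2.1 :=
      (continuous_stopTime c).comp (by fun_prop)
    unfold shrinkFlow shrink move
    fun_prop
  zero x := by rw [shrinkFlow, zero_mul, shrink_zero]
  isTritangent t ht x hx := by
    by_cases h : CanShrink c x
    · obtain ⟨s, h0, hsx, hs, e⟩ := exists_shrinkFlow_eq ht h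
      rw [e]
      exact isTritangent_shrink h0 hsx hx h.2 hs
    · rwa [shrinkFlow_eq_self h]
  eq_self t x h := shrinkFlow_eq_self h
  one x := by
    by_cases h : CanShrink c x
    · rintro ⟨h1, h2⟩
      simp only [shrinkFlow, shrink, stopTime_move, max_eq_left h.1.le, max_eq_left h.2.le,
        one_mul] at h1 h2
      -- At time 1, either the stopping time or the edge length has been used up.
      rcases min_choice (stopTime c x.1) x.2 with e | e <;> rw [e] at h1 h2 <;> linarith
    · rwa [shrinkFlow_eq_self h]

theorem shrinkFlow_snd_nonneg (ht : t ∈ Icc (0 : ℝ) 1) (hx : 0 ≤ x.2) :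
    0 ≤ (shrinkFlow c t x).2 := by
  by_cases h : CanShrink c x
  · obtain ⟨s, -, hsx, -, e⟩ := exists_shrinkFlow_eq ht h
    rw [e]
    exact sub_nonneg.2 hsx
  · rwa [shrinkFlow_eq_self h]

theorem vertexOne_shrinkFlow (ht : t ∈ Icc (0 : ℝ) 1) :
    vertexOne (shrinkFlow c t x) = vertexOne x := by
  by_cases h : CanShrink c x
  · obtain ⟨s, -, hsx, -, e⟩ := exists_shrinkFlow_eq ht h
    rw [e]
    simp only [vertexOne, shrink, move_one_one_fst, move_one_one_snd, abs_of_pos h.1,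
      abs_of_nonneg (sub_nonneg.2 hsx)]
    refine Prod.ext ?_ ?_ <;> simp only <;> ring
  · rw [shrinkFlow_eq_self h]

/-- The edge has positive length and one of its vertices can be moved along it. -/
def CanShrinkPos (c : Fin (3 + 1) × Fin (3 + 1) → ℝ) (x : Params) : Prop :=
  CanShrink c x ∨ CanShrink (negCoeff c) (negLine x)

/-- Move both vertices of an edge of positive length towards each other. -/
def shrinkFlowPos (c : Fin (3 + 1) × Fin (3 + 1) → ℝ) (t : ℝ) (x : Params) : Params :=
  negLine (shrinkFlow (negCoeff c) t (negLine (shrinkFlow c t x)))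

/-- Sliding v₁ leaves v₀ in place, hence also its stopping time, so it cannot make v₀ movable again.
-/
theorem isRetraction_shrinkFlowPos (c : Fin (3 + 1) × Fin (3 + 1) → ℝ) :
    IsRetraction c (CanShrinkPos c) (shrinkFlowPos c) := by
  refine (isRetraction_shrinkFlow c).comp ((isRetraction_shrinkFlow (negCoeff c)).conj
    continuous_negLine (fun x => negLine_negLine) fun x => isTritangent_negLine) fun x hx => ?_
  by_cases h : CanShrink (negCoeff c) (negLine x)
  · rintro ⟨-, h2⟩
    rw [negLine, vertexOne_shrinkFlow ⟨zero_le_one, le_rfl⟩] at h2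
    refine hx ⟨h.1, ?_⟩
    have : (negLine (negLine x)).1 = x.1 := by rw [negLine_negLine]
    exact this ▸ h2
  · rwa [shrinkFlow_eq_self h, negLine_negLine]

theorem shrinkFlowPos_snd_nonneg (ht : t ∈ Icc (0 : ℝ) 1) (hx : 0 ≤ x.2) :
    0 ≤ (shrinkFlowPos c t x).2 :=
  shrinkFlow_snd_nonneg ht (shrinkFlow_snd_nonneg ht hx)

theorem CanShrinkPos.pos (h : CanShrinkPos c x) : 0 < x.2 := by
  rcases h with h | h <;> exact h.1

/-- One of the vertices can be moved along the edge. -/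
def IsShrinkable (c : Fin (3 + 1) × Fin (3 + 1) → ℝ) (x : Params) : Prop :=
  CanShrinkPos c x ∨ CanShrinkPos (mirrorCoeff c) (mirror x)

/-- The flows for ℓ > 0 and ℓ < 0 may bring ℓ to 0 but never change its sign, so they do not
interfere. -/
theorem exists_isRetraction (c : Fin (3 + 1) × Fin (3 + 1) → ℝ) :
    ∃ H, IsRetraction c (IsShrinkable c) H := by
  refine ⟨_, (isRetraction_shrinkFlowPos c).comp ((isRetraction_shrinkFlowPos (mirrorCoeff c)).conj
    continuous_mirror (fun x => mirror_mirror) fun x => isTritangent_mirror) fun x hx => ?_⟩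
  by_cases h : CanShrinkPos (mirrorCoeff c) (mirror x)
  · intro hcon
    have h1 := hcon.pos
    have h2 : 0 ≤ (shrinkFlowPos (mirrorCoeff c) 1 (mirror x)).2 :=
      shrinkFlowPos_snd_nonneg ⟨zero_le_one, le_rfl⟩ h.pos.le
    simp only [mirror] at h1 h2
    linarith
  · rwa [(isRetraction_shrinkFlowPos (mirrorCoeff c)).eq_self 1 _ h, mirror_mirror]

/-- A retraction of the space of tritangent curves restricts to each tritangent class. -/
theorem IsRetraction.isStrongDeformationRetract {B : Params → Prop} {H : ℝ → Params → Params}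
    (hH : IsRetraction c B H) {T : Set Params} (hT : IsTritangentClass c T) :
    IsStrongDeformationRetract {x ∈ T | ¬ B x} T ∧ IsConnected {x ∈ T | ¬ B x} := by
  obtain ⟨x₀, hx₀, rfl⟩ := hT
  set T := connectedComponentIn {y | IsTritangent c y} x₀ with hTdef
  have hTt : ∀ x ∈ T, IsTritangent c x := fun x hx =>
    show x ∈ {y | IsTritangent c y} from connectedComponentIn_subset {y | IsTritangent c y} x₀ hx
  have hmaps : ∀ t ∈ Icc (0 : ℝ) 1, ∀ x ∈ T, H t x ∈ T := by
    intro t ht x hx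
    -- The track of x is a path of tritangent curves, so it stays in the component of x.
    have hpre : IsPreconnected ((fun s => H s x) '' Icc 0 t) :=
      isPreconnected_Icc.image _
        (hH.continuous.comp (continuous_id.prodMk continuous_const)).continuousOn
    have hsub : (fun s => H s x) '' Icc 0 t ⊆ {y | IsTritangent c y} := by
      rintro _ ⟨s, hs, rfl⟩
      exact hH.isTritangent s ⟨hs.1, hs.2.trans ht.2⟩ x (hTt x hx)
    rw [hTdef, connectedComponentIn_eq hx]
    exact hpre.subset_connectedComponentIn ⟨0, ⟨le_rfl, ht.1⟩, hH.zero x⟩ hsub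
      ⟨t, ⟨ht.1, le_rfl⟩, rfl⟩
  have h1 : (1 : ℝ) ∈ Icc (0 : ℝ) 1 := ⟨zero_le_one, le_rfl⟩
  let r : C(T, T) := ⟨fun x => ⟨H 1 x, hmaps 1 h1 x x.2⟩,
    (hH.continuous.comp (continuous_const.prodMk continuous_subtype_val)).subtype_mk _⟩
  refine ⟨⟨fun x hx => hx.1, r, fun x => ⟨(r x).2, hH.one x⟩, ⟨?_⟩⟩, ?_⟩
  · exact
      { toFun := fun p => ⟨H p.1 p.2, hmaps p.1 p.1.2 p.2 p.2.2⟩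
        continuous_toFun := (hH.continuous.comp ((continuous_subtype_val.comp continuous_fst).prodMk
          (continuous_subtype_val.comp continuous_snd))).subtype_mk _
        map_zero_left := fun x => Subtype.ext (hH.zero x)
        map_one_left := fun x => rfl
        prop' := fun t x hx => Subtype.ext (hH.eq_self t x hx.2) }
  · have himage : {x ∈ T | ¬ B x} = H 1 '' T := by
      ext x
      constructor
      · rintro ⟨hx, hB⟩
        exact ⟨x, hx, hH.eq_self 1 x hB⟩
      · rintro ⟨y, hy, rfl⟩
        exact ⟨hmaps 1 h1 y hy, hH.one y⟩
    rw [himage]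
    have hconn : IsConnected T :=
      isConnected_connectedComponentIn_iff.2 (show x₀ ∈ {y | IsTritangent c y} from hx₀)
    exact hconn.image _
      (hH.continuous.comp (continuous_const.prodMk continuous_id)).continuousOn

end

section

/-! ### Relative interiors of polyhedra -/

section Polyhedra

variable {C : Set Params} {x y : Params} {s : Finset ((Params →L[ℝ] ℝ) × ℝ)}

/-- A segment that ends in the relative interior can be prolonged. -/
theorem exists_prolongation_mem (hx : x ∈ intrinsicInterior ℝ C) (hy : y ∈ C) :
    ∃ ε : ℝ, 0 < ε ∧ x + ε • (x - y) ∈ C := by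
  obtain ⟨x', hx', rfl⟩ := mem_intrinsicInterior.1 hx
  have hmem : ∀ r : ℝ, (x' : Params) + r • ((x' : Params) - y) ∈ affineSpan ℝ C := by
    intro r
    have := AffineMap.lineMap_mem (-r) x'.2 (subset_affineSpan ℝ C hy)
    rw [AffineMap.lineMap_apply_module'] at this
    convert this using 1
    module
  have hcont : Continuous fun r : ℝ =>
      (⟨(x' : Params) + r • ((x' : Params) - y), hmem r⟩ : affineSpan ℝ C) :=
    Continuous.subtype_mk (by fun_prop) _
  have hev : ∀ᶠ r : ℝ in 𝓝 0, (x' : Params) + r • ((x' : Params) - y) ∈ C := by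
    have h0 : (⟨(x' : Params) + (0 : ℝ) • ((x' : Params) - y), hmem 0⟩ : affineSpan ℝ C) = x' :=
      Subtype.ext (by simp)
    have hn : ∀ᶠ z : affineSpan ℝ C in 𝓝 ⟨(x' : Params) + (0 : ℝ) • ((x' : Params) - y), hmem 0⟩,
        (z : Params) ∈ C := by
      rw [h0]; exact mem_interior_iff_mem_nhds.1 hx'
    exact (hcont.tendsto 0).eventually hn
  obtain ⟨ε, h1, h2⟩ := ((hev.filter_mono nhdsWithin_le_nhds).and
    (self_mem_nhdsWithin : Ioi (0 : ℝ) ∈ 𝓝[>] 0)).exists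
  exact ⟨ε, h2, h1⟩

/-- If an inequality is active at a relatively interior point, prolonging segments beyond that point
makes it active on all of C. Conversely, inequalities active on C hold with equality on its affine
span, and the remaining ones are strict near x. -/
theorem mem_intrinsicInterior_polyhedron (hC : C = {x | ∀ h ∈ s, h.1 x ≤ h.2}) :
    x ∈ intrinsicInterior ℝ C ↔ x ∈ C ∧ ∀ h ∈ s, h.1 x = h.2 → ∀ y ∈ C, h.1 y = h.2 := by
  constructor
  · intro hx
    refine ⟨intrinsicInterior_subset hx, fun h hs hxh y hy => ?_⟩
    obtain ⟨ε, hε, hmem⟩ := exists_prolongation_mem hx hy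
    rw [hC] at hmem hy
    have h1 := hmem h hs
    have h2 := hy h hs
    rw [map_add, map_smul, map_sub, hxh, smul_eq_mul] at h1
    refine le_antisymm h2 ?_
    have : ε * (h.2 - h.1 y) ≤ 0 := by linarith
    by_contra! hlt
    exact absurd (mul_pos hε (sub_pos.2 hlt)) this.not_gt
  · rintro ⟨hx, hact⟩
    refine mem_intrinsicInterior.2 ⟨⟨x, subset_affineSpan ℝ C hx⟩, ?_, rfl⟩
    refine mem_interior.2 ⟨⋂ h ∈ s.filter fun h => h.1 x < h.2,
      {z : affineSpan ℝ C | h.1 (z : Params) < h.2}, ?_, ?_, ?_⟩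
    · intro z hz
      have hmem : (z : Params) ∈ C ↔ ∀ h ∈ s, h.1 (z : Params) ≤ h.2 :=
        iff_of_eq (congrArg ((z : Params) ∈ ·) hC)
      refine hmem.2 fun h hs => ?_
      rcases lt_or_ge (h.1 x) h.2 with hlt | hge
      · exact (mem_iInter₂.1 hz h (Finset.mem_filter.2 ⟨hs, hlt⟩)).le
      · have hxC := hx
        rw [hC] at hxC
        have hall := hact h hs (le_antisymm (hxC h hs) hge)
        refine le_of_eq (affineSpan_induction (p := fun z => h.1 z = h.2) z.2 hall ?_)
        intro r u v w hu hv hw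
        simp [hu, hv, hw]
    · exact isOpen_biInter_finset fun h _ =>
        isOpen_lt (h.1.continuous.comp continuous_subtype_val) continuous_const
    · exact mem_iInter₂.2 fun h hh => (Finset.mem_filter.1 hh).2

theorem IsPolyhedron.convex (hC : IsPolyhedron C) : Convex ℝ C := by
  obtain ⟨s, rfl⟩ := hC
  intro x hx y hy a b ha hb hab h hs
  rw [map_add, map_smul, map_smul, smul_eq_mul, smul_eq_mul]
  calc a * h.1 x + b * h.1 y ≤ a * h.2 + b * h.2 :=
        add_le_add (mul_le_mul_of_nonneg_left (hx h hs) ha)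
          (mul_le_mul_of_nonneg_left (hy h hs) hb)
    _ = h.2 := by rw [← add_mul, hab, one_mul]

theorem IsPolyhedron.combo_mem_intrinsicInterior (hC : IsPolyhedron C)
    (hx : x ∈ intrinsicInterior ℝ C) (hy : y ∈ C) {a b : ℝ} (ha : 0 < a) (hb : 0 ≤ b)
    (hab : a + b = 1) : a • x + b • y ∈ intrinsicInterior ℝ C := by
  have hconv := hC.convex
  obtain ⟨s, hs⟩ := hC
  rw [mem_intrinsicInterior_polyhedron hs] at hx ⊢
  refine ⟨hconv hx.1 hy ha.le hb hab, fun h hh heq => hx.2 h hh ?_⟩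
  have hxC := hx.1
  rw [hs] at hxC hy
  have h1 := hxC h hh
  have h2 := mul_le_mul_of_nonneg_left (hy h hh) hb
  rw [map_add, map_smul, map_smul, smul_eq_mul, smul_eq_mul] at heq
  refine le_antisymm h1 ?_
  have h3 : a * h.2 ≤ a * h.1 x := by
    have : a * h.2 + b * h.2 = h.2 := by rw [← add_mul, hab, one_mul]
    linarith
  exact le_of_mul_le_mul_left h3 ha

theorem IsPolyhedron.subset_closure_intrinsicInterior (hC : IsPolyhedron C) :
    C ⊆ closure (intrinsicInterior ℝ C) := by
  intro x hx
  obtain ⟨y, hy⟩ := Set.Nonempty.intrinsicInterior hC.convex ⟨x, hx⟩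
  have hcont : Continuous fun r : ℝ => r • y + (1 - r) • x := by fun_prop
  have hlim : Tendsto (fun r : ℝ => r • y + (1 - r) • x) (𝓝[>] 0) (𝓝 x) := by
    have := hcont.tendsto 0
    simp only [zero_smul, sub_zero, one_smul, zero_add] at this
    exact this.mono_left nhdsWithin_le_nhds
  refine mem_closure_of_tendsto hlim ?_
  filter_upwards [Ioo_mem_nhdsGT (zero_lt_one' ℝ)] with r hr
  exact hC.combo_mem_intrinsicInterior hy hx hr.1 (sub_nonneg.2 hr.2.le) (by ring)

/-- The zero lies on the segment from y to x; prolonging that segment slightly past x makes f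
negative. It is applied with f = ±ℓ. -/
theorem IsPolyhedron.exists_zero_and_neg (hC : IsPolyhedron C)
    (hx : x ∈ intrinsicInterior ℝ C) (hy : y ∈ intrinsicInterior ℝ C) {f : Params →L[ℝ] ℝ}
    (hfx : f x ≤ 0) (hfy : 0 < f y) :
    (∃ z ∈ intrinsicInterior ℝ C, f z = 0) ∧ ∃ z ∈ intrinsicInterior ℝ C, f z < 0 := by
  have hd : 0 < f y - f x := by linarith
  constructor
  · refine ⟨(f y / (f y - f x)) • x + (-f x / (f y - f x)) • y,
      hC.combo_mem_intrinsicInterior hx (intrinsicInterior_subset hy) (div_pos hfy hd)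
        (div_nonneg (by linarith) hd.le) ?_, ?_⟩
    · rw [← add_div, ← sub_eq_add_neg, div_self hd.ne']
    · rw [map_add, map_smul, map_smul, smul_eq_mul, smul_eq_mul]
      field_simp
      ring
  · obtain ⟨ε, hε, hmem⟩ := exists_prolongation_mem hx (intrinsicInterior_subset hy)
    refine ⟨(1 / 2 : ℝ) • x + (1 / 2 : ℝ) • (x + ε • (x - y)),
      hC.combo_mem_intrinsicInterior hx hmem (by norm_num) (by norm_num) (by norm_num), ?_⟩
    simp only [map_add, map_smul, map_sub, smul_eq_mul]
    nlinarith

/-- Every point of the support of a polyhedral complex lies in the relative interior of a cell. -/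
theorem PolyhedralComplex.exists_mem_intrinsicInterior (K : PolyhedralComplex)
    (hx : x ∈ support K.cells) : ∃ F ∈ K.cells, x ∈ intrinsicInterior ℝ F := by
  classical
  obtain ⟨C, hC, hxC⟩ := hx
  obtain ⟨s, hs⟩ := K.isPolyhedron_of_mem C hC
  have hle : ∀ y ∈ C, ∀ h ∈ s, h.1 y ≤ h.2 := by
    intro y hy
    rw [hs] at hy
    exact hy
  set A := s.filter fun h => h.1 x = h.2 with hA
  set F := {y ∈ C | ∀ h ∈ A, h.1 y = h.2} with hF
  have hxF : x ∈ F := ⟨hxC, fun h hh => (Finset.mem_filter.1 hh).2⟩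
  have hexp : IsExposed ℝ C F := by
    intro _
    -- The sum of the constraints active at x is bounded on C by the sum of their right-hand sides;
    -- this bound is attained at x, so the maximisers are the points where all of them are active.
    refine ⟨∑ h ∈ A, h.1, ?_⟩
    have hsum : ∀ y, (∑ h ∈ A, h.1) y = ∑ h ∈ A, h.1 y := fun y => by simp
    ext y
    refine and_congr_right fun hy => ?_
    simp only [hsum]
    constructor
    · intro h1 z hz
      refine Finset.sum_le_sum fun h hh => ?_
      rw [h1 h hh]
      exact hle z hz h (Finset.mem_filter.1 hh).1
    · intro h1
      have h2 := h1 x hxC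
      have h3 : ∑ h ∈ A, h.1 x = ∑ h ∈ A, h.2 :=
        Finset.sum_congr rfl fun h hh => (Finset.mem_filter.1 hh).2
      have h4 : ∀ h ∈ A, h.1 y ≤ h.2 := fun h hh => hle y hy h (Finset.mem_filter.1 hh).1
      exact (Finset.sum_eq_sum_iff_of_le h4).1 (le_antisymm (Finset.sum_le_sum h4) (h3 ▸ h2))
  have hFcell := K.face_mem C hC F ⟨x, hxF⟩ hexp
  refine ⟨F, hFcell, ?_⟩
  have hFpoly : F = {y | ∀ h ∈ s ∪ A.image fun h => (-h.1, -h.2), h.1 y ≤ h.2} := by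
    ext y
    simp only [hF, hs, mem_ofPred_eq, Finset.mem_union, Finset.mem_image, or_imp, forall_and,
      forall_exists_index, and_imp, forall_apply_eq_imp_iff₂]
    refine and_congr_right fun hy => forall₂_congr fun h hh => ?_
    have h1 := hy h (Finset.mem_filter.1 hh).1
    simp only [neg_apply, neg_le_neg_iff]
    exact ⟨fun e => e.ge, fun e => le_antisymm h1 e⟩
  rw [mem_intrinsicInterior_polyhedron hFpoly]
  refine ⟨hxF, fun h hh hxh y hy => ?_⟩
  rcases Finset.mem_union.1 hh with hh | hh
  · exact hy.2 h (Finset.mem_filter.2 ⟨hh, hxh⟩)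
  · obtain ⟨h', hh', rfl⟩ := Finset.mem_image.1 hh
    simp [hy.2 h' hh']

end Polyhedra

end

section

variable {c : Fin (3 + 1) × Fin (3 + 1) → ℝ} {x y z : Params}

/-! ### Shrinkable curves and the bounded subcomplex -/

theorem dualCell_negCoeff_eq_singleton {p : ℝ × ℝ} {a : Fin (3 + 1) × Fin (3 + 1)} :
    dualCell (negCoeff c) (-p) = {(a.1.rev, a.2.rev)} ↔ dualCell c p = {a} := by
  rw [dualCell_eq_map _ fun b => monomial_negCoeff (c := c) b p,
    show ({(a.1.rev, a.2.rev)} : Finset (Fin (3 + 1) × Fin (3 + 1))) =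
      Finset.map (Fin.revPerm.prodCongr Fin.revPerm).toEmbedding {a} from rfl, Finset.map_inj]

theorem dualCell_mirrorCoeff_eq_singleton {p : ℝ × ℝ} {a : Fin (3 + 1) × Fin (3 + 1)} :
    dualCell (mirrorCoeff c) (-p.1, p.2) = {(a.1.rev, a.2)} ↔ dualCell c p = {a} := by
  rw [dualCell_eq_map _ fun b => monomial_mirrorCoeff (c := c) b p,
    show ({(a.1.rev, a.2)} : Finset (Fin (3 + 1) × Fin (3 + 1))) =
      Finset.map (Fin.revPerm.prodCongr (Equiv.refl _)).toEmbedding {a} from rfl, Finset.map_inj]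

theorem IsSmooth.negCoeff (hc : IsSmooth c) : IsSmooth (negCoeff c) := by
  intro p
  rw [← neg_neg p]
  obtain ⟨h1, h2⟩ := hc (-p)
  constructor
  · rw [dualCell_eq_map _ fun b => monomial_negCoeff (c := c) b (-p), Finset.card_map]
    exact h1
  · intro a ha b hb e he hab hae hbe
    rw [mem_dualCell_negCoeff] at ha hb he
    rw [← h2 _ ha _ hb _ he
      (fun h => hab (Prod.ext (Fin.rev_injective (Prod.ext_iff.1 h).1)
        (Fin.rev_injective (Prod.ext_iff.1 h).2)))
      (fun h => hae (Prod.ext (Fin.rev_injective (Prod.ext_iff.1 h).1)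
        (Fin.rev_injective (Prod.ext_iff.1 h).2)))
      (fun h => hbe (Prod.ext (Fin.rev_injective (Prod.ext_iff.1 h).1)
        (Fin.rev_injective (Prod.ext_iff.1 h).2)))]
    simp only [latticeDet, cast_rev]
    congr 1
    ring

theorem IsSmooth.mirrorCoeff (hc : IsSmooth c) : IsSmooth (mirrorCoeff c) := by
  intro p
  have hp : p = (-(-p.1, p.2).1, (-p.1, p.2).2) := by simp
  rw [hp]
  obtain ⟨h1, h2⟩ := hc (-p.1, p.2)
  constructor
  · rw [dualCell_eq_map _ fun b => monomial_mirrorCoeff (c := c) b (-p.1, p.2), Finset.card_map]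
    exact h1
  · intro a ha b hb e he hab hae hbe
    rw [mem_dualCell_mirrorCoeff] at ha hb he
    rw [← h2 _ ha _ hb _ he
      (fun h => hab (Prod.ext (Fin.rev_injective (Prod.ext_iff.1 h).1) (Prod.ext_iff.1 h).2))
      (fun h => hae (Prod.ext (Fin.rev_injective (Prod.ext_iff.1 h).1) (Prod.ext_iff.1 h).2))
      (fun h => hbe (Prod.ext (Fin.rev_injective (Prod.ext_iff.1 h).1) (Prod.ext_iff.1 h).2)),
      ← abs_neg]
    simp only [latticeDet, cast_rev]
    congr 1
    ring

/-- For tritangent curves, the lower vertex can be moved up along the edge if and only if one of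
the conditions that define the unbounded cells holds at the lower vertex. -/
theorem canShrink_iff (hc : IsSmooth c) (h : IsTritangent c x) : CanShrink c x ↔
    0 < x.2 ∧ dualCell c x.1 = {(0, 0)} ∨
    0 < x.2 ∧ ((1, 0) ∈ dualCell c x.1 ∧ (0, 1) ∈ dualCell c x.1) ∧
      (0, 2) ∉ dualCell c x.1 ∧ (1, 1) ∉ dualCell c x.1 ∧ (2, 0) ∉ dualCell c x.1 := by
  rw [CanShrink, stopTime_pos]
  constructor
  · rintro ⟨hx, hsub⟩
    rcases dualCell_vertexZero_of_subset hx h hsub with h1 | h1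
    · exact Or.inl ⟨hx, h1⟩
    · exact Or.inr ⟨hx, h1, fun h => absurd (hsub h) (by decide),
        fun h => absurd (hsub h) (by decide), fun h => absurd (hsub h) (by decide)⟩
  · rintro (⟨hx, h1⟩ | ⟨hx, ⟨h10, h01⟩, h02, h11, h20⟩)
    · exact ⟨hx, by rw [h1]; decide⟩
    · refine ⟨hx, fun e he => ?_⟩
      by_contra hlow
      -- The determinant is 1 - e₁ - e₂, so a unimodular triangle on (1,0), (0,1) has its third
      -- vertex in degree 0 or 2.
      have hdet : ∀ e : Fin (3 + 1) × Fin (3 + 1), e ∉ lowExponents → e ≠ (0, 2) → e ≠ (1, 1) →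
          e ≠ (2, 0) → |latticeDet (1, 0) (0, 1) e| ≠ 1 := by decide
      exact hdet e hlow (fun h => h02 (h ▸ he)) (fun h => h11 (h ▸ he)) (fun h => h20 (h ▸ he))
        ((hc x.1).2 _ h10 _ h01 _ he (by decide) (fun h => hlow (h ▸ by decide))
          (fun h => hlow (h ▸ by decide)))

theorem vertexOne_mirror (x : Params) :
    vertexOne (mirror x) = (-(vertexOne x).1, (vertexOne x).2) := by
  simp [vertexOne, mirror, add_comm]

theorem vertexOne_negLine (x : Params) : vertexOne (negLine x) = -x.1 := by
  simp only [vertexOne, negLine, Prod.fst_neg, Prod.snd_neg]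
  refine Prod.ext ?_ ?_ <;> simp

/-- The eight conditions are the two of `canShrink_iff`, read for Γ and for its images under
negation, reflection and both. -/
theorem isShrinkable_iff (hc : IsSmooth c) (h : IsTritangent c x) :
    IsShrinkable c x ↔ InU c x ∨ InR c x := by
  have e0 := canShrink_iff hc h
  have e1 := canShrink_iff hc.negCoeff (isTritangent_negLine.2 h)
  have e2 := canShrink_iff hc.mirrorCoeff (isTritangent_mirror.2 h)
  have e3 := canShrink_iff hc.mirrorCoeff.negCoeff
    (isTritangent_negLine.2 (isTritangent_mirror.2 h))
  have n1 : (negLine x).1 = -vertexOne x := rfl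
  have n2 : (mirror x).1 = (-x.1.1, x.1.2) := rfl
  have n3 : (negLine (mirror x)).1 = -(-(vertexOne x).1, (vertexOne x).2) := by
    rw [← vertexOne_mirror]; rfl
  have s1 : dualCell (negCoeff c) (-vertexOne x) = {(0, 0)} ↔ dualCell c (vertexOne x) = {(3, 3)} :=
    dualCell_negCoeff_eq_singleton (a := (3, 3))
  have s2 : dualCell (mirrorCoeff c) (-x.1.1, x.1.2) = {(0, 0)} ↔ dualCell c x.1 = {(3, 0)} :=
    dualCell_mirrorCoeff_eq_singleton (a := (3, 0))
  have s3 : dualCell (negCoeff (mirrorCoeff c)) (-(-(vertexOne x).1, (vertexOne x).2)) = {(0, 0)} ↔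
      dualCell c (vertexOne x) = {(0, 3)} :=
    (dualCell_negCoeff_eq_singleton (a := (3, 3))).trans
      (dualCell_mirrorCoeff_eq_singleton (a := (0, 3)))
  rw [n1, s1] at e1
  rw [n2, s2] at e2
  rw [n3, s3] at e3
  simp only [mem_dualCell_negCoeff, mem_dualCell_mirrorCoeff] at e1 e2 e3
  rw [IsShrinkable, CanShrinkPos, CanShrinkPos, e0, e1, e2, e3, InU, InR]
  simp only [chamber, vertexZero, mem_ofPred_eq, Finset.insert_subset_iff,
    Finset.singleton_subset_iff, Finset.disjoint_insert_left, Finset.disjoint_singleton_left]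
  have p1 : 0 < (mirror x).2 ↔ x.2 < 0 := by simp [mirror]
  have p2 : 0 < (negLine (mirror x)).2 ↔ x.2 < 0 := p1
  have p3 : 0 < (negLine x).2 ↔ 0 < x.2 := Iff.rfl
  rw [p1, p2, p3]
  have r0 : Fin.rev (0 : Fin (3 + 1)) = 3 := rfl
  have r1 : Fin.rev (1 : Fin (3 + 1)) = 2 := rfl
  have r2 : Fin.rev (2 : Fin (3 + 1)) = 1 := rfl
  have r3 : Fin.rev (3 : Fin (3 + 1)) = 0 := rfl
  simp only [r0, r1, r2, r3]
  constructor
  · rintro (((h | ⟨h, ⟨p, q⟩, h1, h2, h3⟩) | (h | ⟨h, ⟨p, q⟩, h1, h2, h3⟩)) |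
      ((h | ⟨h, ⟨p, q⟩, h1, h2, h3⟩) | (h | ⟨h, ⟨p, q⟩, h1, h2, h3⟩)))
    · exact Or.inl (Or.inl h)
    · exact Or.inr (Or.inl ⟨h, ⟨p, q⟩, h1, h2, h3⟩)
    · exact Or.inl (Or.inr (Or.inl h))
    · exact Or.inr (Or.inr (Or.inl ⟨h, ⟨p, q⟩, h3, h2, h1⟩))
    · exact Or.inl (Or.inr (Or.inr (Or.inl h)))
    · exact Or.inr (Or.inr (Or.inr (Or.inl ⟨h, ⟨p, q⟩, h3, h2, h1⟩)))
    · exact Or.inl (Or.inr (Or.inr (Or.inr h)))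
    · exact Or.inr (Or.inr (Or.inr (Or.inr ⟨h, ⟨q, p⟩, h1, h2, h3⟩)))
  · rintro ((h | h | h | h) | (⟨h, ⟨p, q⟩, h1, h2, h3⟩ | ⟨h, ⟨p, q⟩, h1, h2, h3⟩ |
      ⟨h, ⟨p, q⟩, h1, h2, h3⟩ | ⟨h, ⟨p, q⟩, h1, h2, h3⟩))
    · exact Or.inl (Or.inl (Or.inl h))
    · exact Or.inl (Or.inr (Or.inl h))
    · exact Or.inr (Or.inl (Or.inl h))
    · exact Or.inr (Or.inr (Or.inl h))
    · exact Or.inl (Or.inl (Or.inr ⟨h, ⟨p, q⟩, h1, h2, h3⟩))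
    · exact Or.inl (Or.inr (Or.inr ⟨h, ⟨p, q⟩, h3, h2, h1⟩))
    · exact Or.inr (Or.inl (Or.inr ⟨h, ⟨p, q⟩, h3, h2, h1⟩))
    · exact Or.inr (Or.inr (Or.inr ⟨h, ⟨q, p⟩, h1, h2, h3⟩))

/-! ### Constancy of shrinkability on relative interiors -/

/-- The vertices of two `(1, 1)`-curves lie in the same open cells of the plane. -/
def SameCells (c : Fin (3 + 1) × Fin (3 + 1) → ℝ) (x y : Params) : Prop :=
  dualCell c (vertexZero x) = dualCell c (vertexZero y) ∧
    dualCell c (vertexOne x) = dualCell c (vertexOne y)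

theorem SameCells.negLine (h : SameCells c x y) :
    SameCells (negCoeff c) (negLine x) (negLine y) := by
  constructor
  · ext a
    exact mem_dualCell_negCoeff.trans ((by rw [h.2] : _ ↔ _).trans mem_dualCell_negCoeff.symm)
  · rw [vertexOne_negLine, vertexOne_negLine]
    ext a
    exact mem_dualCell_negCoeff.trans
      ((by rw [show x.1 = vertexZero x from rfl, h.1]; rfl : _ ↔ _).trans
        mem_dualCell_negCoeff.symm)

theorem SameCells.mirror (h : SameCells c x y) :
    SameCells (mirrorCoeff c) (mirror x) (mirror y) := by
  constructor
  · ext a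
    exact mem_dualCell_mirrorCoeff.trans
      ((by rw [show x.1 = vertexZero x from rfl, h.1]; rfl : _ ↔ _).trans
        mem_dualCell_mirrorCoeff.symm)
  · rw [vertexOne_mirror, vertexOne_mirror]
    ext a
    exact mem_dualCell_mirrorCoeff.trans
      ((by rw [h.2] : _ ↔ _).trans mem_dualCell_mirrorCoeff.symm)

/-- The open cells of the vertices of a shrinkable curve determine the sign of the edge length. -/
theorem not_canShrink_of_sameCells (h : IsTritangent c y) (hy : CanShrink c y)
    (hz : SameCells c z y) (hz0 : z.2 = 0) (hx : SameCells c x y) (hx0 : x.2 < 0) : False := by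
  have hsub := stopTime_pos.1 hy.2
  have hz1 : vertexOne z = vertexZero z := by simp [vertexOne, vertexZero, hz0]
  -- The two vertices of z coincide, so both vertices of y lie in the same open cell.
  have hD : dualCell c (vertexOne y) = dualCell c y.1 := by
    rw [← hz.2, hz1, hz.1]; rfl
  rcases dualCell_vertexZero_of_subset hy.1 h hsub with h0 | ⟨h10, h01⟩
  · have h1 : dualCell (negCoeff c) (negLine y).1 = {(3, 3)} :=
      dualCell_negCoeff_eq_singleton (a := (0, 0)).2 (hD.trans h0)
    exact absurd (even_fst_of_dualCell_eq_singleton (x := negLine y) hy.1.le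
      (isTritangent_negLine.2 h) h1) (by decide)
  · have e0 : dualCell c (vertexZero x) = dualCell c y.1 := hx.1
    have e1 := hx.2.trans hD
    -- Both vertices of x lie on the line of slope 1 where (1,0) and (0,1) tie, whereas its edge has
    -- slope -1.
    have k0 := monomial_eq_of_mem_dualCell (e0 ▸ h10 : (1, 0) ∈ dualCell c (vertexZero x))
      (e0 ▸ h01 : (0, 1) ∈ dualCell c (vertexZero x))
    have k1 := monomial_eq_of_mem_dualCell (e1 ▸ h10 : (1, 0) ∈ dualCell c (vertexOne x))
      (e1 ▸ h01 : (0, 1) ∈ dualCell c (vertexOne x))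
    simp [monomial, vertexZero, vertexOne, abs_of_neg hx0] at k0 k1
    linarith

theorem not_canShrinkPos_of_sameCells (h : IsTritangent c y) (hy : CanShrinkPos c y)
    (hz : SameCells c z y) (hz0 : z.2 = 0) (hx : SameCells c x y) (hx0 : x.2 < 0) : False := by
  rcases hy with hy | hy
  · exact not_canShrink_of_sameCells h hy hz hz0 hx hx0
  · exact not_canShrink_of_sameCells (isTritangent_negLine.2 h) hy hz.negLine hz0 hx.negLine hx0

theorem CanShrink.congr (h : CanShrink c y) (hxy : SameCells c x y) (hx : 0 < x.2) :
    CanShrink c x :=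
  ⟨hx, stopTime_pos.2 (by
    rw [show dualCell c x.1 = dualCell c y.1 from hxy.1]
    exact stopTime_pos.1 h.2)⟩

theorem CanShrinkPos.congr (h : CanShrinkPos c y) (hxy : SameCells c x y) (hx : 0 < x.2) :
    CanShrinkPos c x := by
  rcases h with h | h
  · exact Or.inl (h.congr hxy hx)
  · exact Or.inr (h.congr hxy.negLine hx)

/-- Shrinkability is constant on the relative interiors of the cells. -/
theorem IsShrinkable.of_mem_intrinsicInterior {C : Set Params} (hC : IsPolyhedron C)
    (hcell : ∀ x ∈ intrinsicInterior ℝ C, ∀ y ∈ intrinsicInterior ℝ C, SameCells c x y)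
    (hy : y ∈ intrinsicInterior ℝ C) (hx : x ∈ intrinsicInterior ℝ C) (h : IsTritangent c y)
    (hs : IsShrinkable c y) : IsShrinkable c x := by
  rcases hs with hs | hs
  · refine Or.inl (hs.congr (hcell x hx y hy) ?_)
    -- Equal cells transfer shrinkability only once the sign of ℓ is known. If it failed, the
    -- relative interior would contain members with ℓ = 0 and with ℓ < 0.
    by_contra! hx0
    obtain ⟨⟨z, hz, hz0⟩, w, hw, hw0⟩ := hC.exists_zero_and_neg hx hy
      (f := ContinuousLinearMap.snd ℝ (ℝ × ℝ) ℝ) hx0 hs.pos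
    exact not_canShrinkPos_of_sameCells h hs (hcell z hz y hy) hz0 (hcell w hw y hy) hw0
  · refine Or.inr (hs.congr (hcell x hx y hy).mirror ?_)
    by_contra! hx0
    obtain ⟨⟨z, hz, hz0⟩, w, hw, hw0⟩ := hC.exists_zero_and_neg hx hy
      (f := -ContinuousLinearMap.snd ℝ (ℝ × ℝ) ℝ) hx0 hs.pos
    exact not_canShrinkPos_of_sameCells (isTritangent_mirror.2 h) hs (hcell z hz y hy).mirror hz0
      (hcell w hw y hy).mirror hw0

theorem isOpen_canShrink (c : Fin (3 + 1) × Fin (3 + 1) → ℝ) : IsOpen {x | CanShrink c x} :=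
  (isOpen_lt continuous_const continuous_snd).inter
    (isOpen_lt continuous_const ((continuous_stopTime c).comp continuous_fst))

theorem isOpen_canShrinkPos (c : Fin (3 + 1) × Fin (3 + 1) → ℝ) : IsOpen {x | CanShrinkPos c x} :=
  (isOpen_canShrink c).union ((isOpen_canShrink (negCoeff c)).preimage continuous_negLine)

theorem isOpen_isShrinkable (c : Fin (3 + 1) × Fin (3 + 1) → ℝ) : IsOpen {x | IsShrinkable c x} :=
  (isOpen_canShrinkPos c).union ((isOpen_canShrinkPos (mirrorCoeff c)).preimage continuous_mirror)

/-- The support of the bounded subcomplex consists of the members that are not shrinkable. -/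
theorem support_boundedCells (hc : IsSmooth c) {T : Set Params} (hT : IsTritangentClass c T)
    (K : PolyhedralComplex) (hK : support K.cells = T) (hKc : K.IsCompatible c) :
    support (K.boundedCells c) = {x ∈ T | ¬ IsShrinkable c x} := by
  have htrit : ∀ x ∈ T, IsTritangent c x := by
    obtain ⟨x₀, -, rfl⟩ := hT
    exact fun x hx => show x ∈ {y | IsTritangent c y} from
      connectedComponentIn_subset {y | IsTritangent c y} x₀ hx
  have hcells : ∀ C ∈ K.cells, intrinsicInterior ℝ C ⊆ T := fun C hC =>
    intrinsicInterior_subset.trans (hK ▸ subset_sUnion_of_mem hC)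
  ext x
  constructor
  · rintro ⟨C, ⟨hC, hbd⟩, hxC⟩
    refine ⟨hK ▸ ⟨C, hC, hxC⟩, fun hs => hbd ?_⟩
    -- Every point of C is a limit of relatively interior ones, and shrinkability is open, so a
    -- shrinkable member of C would yield one in the relative interior.
    obtain ⟨y, hy, hyC⟩ := mem_closure_iff.1
      ((K.isPolyhedron_of_mem C hC).subset_closure_intrinsicInterior hxC)
      {x | IsShrinkable c x} (isOpen_isShrinkable c) hs
    exact ⟨y, hyC, (isShrinkable_iff hc (htrit y (hcells C hC hyC))).1 hy⟩
  · rintro ⟨hxT, hs⟩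
    obtain ⟨F, hF, hxF⟩ := K.exists_mem_intrinsicInterior (hK ▸ hxT : x ∈ support K.cells)
    refine ⟨F, ⟨hF, ?_⟩, intrinsicInterior_subset hxF⟩
    rintro ⟨y, hy, hyb⟩
    have hyt := htrit y (hcells F hF hy)
    exact hs (IsShrinkable.of_mem_intrinsicInterior (K.isPolyhedron_of_mem F hF) (hKc F hF) hy hxF
      hyt ((isShrinkable_iff hc hyt).2 hyb))

end

end TropicalTritangent

end

theorem mainTheorem8 (c : Fin (3 + 1) × Fin (3 + 1) → ℝ) (hc : TropicalTritangent.IsSmooth c)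
    (T : Set TropicalTritangent.Params) (hT : TropicalTritangent.IsTritangentClass c T)
    (K : TropicalTritangent.PolyhedralComplex)
    (hK : TropicalTritangent.support K.cells = T) (hKc : K.IsCompatible c) :
    TropicalTritangent.IsStrongDeformationRetract
      (TropicalTritangent.support (K.boundedCells c)) T ∧
    IsConnected (TropicalTritangent.support (K.boundedCells c)) := by
  obtain ⟨H, hH⟩ := TropicalTritangent.exists_isRetraction c
  rw [TropicalTritangent.support_boundedCells hc hT K hK hKc]
  exact hH.isStrongDeformationRetract hT
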